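/- Let $\mathbb{H}$ denote the real quaternions, let $\|\cdot\|_F$ be the Frobenius norm, $M^*$ the conjugate transpose and $M^\dagger$ the Moore--Penrose inverse of a quaternion matrix $M$, and let $\mathcal R(M)$ be the set of right linear combinations of the columns of $M$. A random matrix in $\mathbb{H}^{p\times q}$ is called standard Gaussian if the $4pq$ real coordinates of its entries are independent standard normal random variables. Let $m\ge n$ and $r\le s\le l\le \min\{m,n\}$ be non-negative integers, and let $A\in\mathbb{H}^{m\times n}$ have the quaternion singular value decomposition $A=U\Sigma V^*$, where $U\in\mathbb{H}^{m\times n}$ satisfies $U^*U=I_n$, $V\in\mathbb{H}^{n\times n}$ is unitary and $\Sigma=\operatorname{diag}(\sigma_1,\dots,\sigma_n)$ with $\sigma_1\ge\cdots\ge\sigma_n\ge 0$; put $\Sigma_2=\operatorname{diag}(\sigma_{r+1},\dots,\sigma_n)$. Let $\Omega\in\mathbb{H}^{n\times s}$ and $\Psi\in\mathbb{H}^{l\times m}$ be independent standard Gaussian matrices, and form the sketches $Y=A\Omega$ and $W=\Psi A$. Let $H\in\mathbb{H}^{m\times s}$ be any range-preserving rangefinder for $Y$, that is, almost surely $\mathcal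 R(H)=\mathcal R(Y)$ and $H$ has full column rank (its columns are right linearly independent), and let $X=(\Psi H)^\dagger W$. With $f(a,b)=\dfrac{4a}{4(b-a)+2}$, the random variable $\|HX-A\|_F^2$ is integrable and $$\mathbb{E}\|HX-A\|_F^2\le (1+f(s,l))(1+f(r,s))\|\Sigma_2\|_F^2=\frac{2l+1}{2(l-s)+1}\cdot\frac{2s+1}{2(s-r)+1}\,\|\Sigma_2\|_F^2 .$$ -/

import Mathlib

open MeasureTheory ProbabilityTheory
open scoped Quaternion Matrix Matrix.Norms.Frobenius

namespace QuaternionSketch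

/-- The four Penrose equations: `X` is a Moore--Penrose inverse of the quaternion matrix `A`. -/
structure IsMoorePenrose {m n : ℕ} (A : Matrix (Fin m) (Fin n) ℍ[ℝ])
    (X : Matrix (Fin n) (Fin m) ℍ[ℝ]) : Prop where
  mul_mul_self : A * X * A = A
  self_mul_mul : X * A * X = X
  left_hermitian : (A * X)ᴴ = A * X
  right_hermitian : (X * A)ᴴ = X * A

theorem eq_zero_of_conjTranspose_mul_self {m n : ℕ} {C : Matrix (Fin m) (Fin n) ℍ[ℝ]}
    (h : Cᴴ * C = 0) : C = 0 := by
  ext1 i j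
  have h1 := congrFun (congrFun h j) j
  rw [Matrix.mul_apply] at h1
  simp only [Matrix.conjTranspose_apply, Matrix.zero_apply, Quaternion.star_mul_self] at h1
  have h2 : ∑ x, Quaternion.normSq (C x j) = 0 := by
    have h3 : ((∑ x, Quaternion.normSq (C x j) : ℝ) : ℍ[ℝ]) = 0 := by
      rw [← h1]
      exact map_sum (algebraMap ℝ ℍ[ℝ]) (fun x => Quaternion.normSq (C x j)) Finset.univ
    exact Quaternion.coe_injective h3
  have h4 := (Finset.sum_eq_zero_iff_of_nonneg
    (fun x _ => Quaternion.normSq_nonneg)).1 h2 i (Finset.mem_univ i)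
  simpa using Quaternion.normSq_eq_zero.1 h4

theorem exists_isMoorePenrose {m n : ℕ} (A : Matrix (Fin m) (Fin n) ℍ[ℝ]) :
    ∃ X, IsMoorePenrose A X := by
  set B : Matrix (Fin n) (Fin n) ℍ[ℝ] := Aᴴ * A with hB
  have hBH : Bᴴ = B := by simp [hB, Matrix.conjTranspose_mul]
  have hred : ∀ (k : ℕ) (C : Matrix (Fin n) (Fin n) ℍ[ℝ]), B ^ (k + 1) * C = 0 → B * C = 0 := by
    intro k
    induction k with
    | zero => intro C h; simpa using h
    | succ k ih =>
      intro C h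
      have h1 : B * (B * C) = 0 := by
        apply ih
        rw [h.symm, pow_succ B (k + 1)]
        noncomm_ring
      refine eq_zero_of_conjTranspose_mul_self ?_
      rw [Matrix.conjTranspose_mul, hBH, Matrix.mul_assoc, h1, Matrix.mul_zero]
  have hH : ∀ q : Polynomial ℝ, (Polynomial.aeval B q)ᴴ = Polynomial.aeval B q := by
    intro q
    induction q using Polynomial.induction_on' with
    | add p q hp hq => simp [hp, hq]
    | monomial k a =>
      have h1 : (a • B ^ k)ᴴ = a • (B ^ k)ᴴ := by
        ext1 i j
        exact Quaternion.star_smul a ((B ^ k) j i)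
      rw [Polynomial.aeval_monomial, Algebra.algebraMap_eq_smul_one, Matrix.smul_mul,
        Matrix.one_mul, h1, Matrix.conjTranspose_pow, hBH]
  obtain ⟨p, hp0, hp⟩ : ∃ p : Polynomial ℝ, p ≠ 0 ∧ Polynomial.aeval B p = 0 :=
    Algebra.IsAlgebraic.isAlgebraic (R := ℝ) B
  obtain ⟨q, hpq, hq⟩ := Polynomial.exists_eq_pow_rootMultiplicity_mul_and_not_dvd p hp0 0
  have hq0 : q.coeff 0 ≠ 0 := by
    intro h
    apply hq
    simpa using Polynomial.X_dvd_iff.2 h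
  have hBq : B * Polynomial.aeval B q = 0 := by
    apply hred (Polynomial.rootMultiplicity 0 p)
    rw [hpq] at hp
    simp only [map_zero, sub_zero, map_mul, map_pow, Polynomial.aeval_X] at hp
    rw [pow_succ', Matrix.mul_assoc, hp, Matrix.mul_zero]
  set D : Matrix (Fin n) (Fin n) ℍ[ℝ] :=
    Polynomial.aeval B (Polynomial.C (-(q.coeff 0)⁻¹) * q.divX) with hD
  have hDH : Dᴴ = D := hH _
  have hcomm : D * B = B * D := by
    have h := congrArg (Polynomial.aeval B) (mul_comm
      (Polynomial.C (-(q.coeff 0)⁻¹) * q.divX) Polynomial.X)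
    rwa [map_mul _ _ Polynomial.X, map_mul _ Polynomial.X, Polynomial.aeval_X, ← hD] at h
  have hBDB : B * D * B = B := by
    have h1 := congrArg (Polynomial.aeval B) (Polynomial.divX_mul_X_add q)
    rw [map_add, map_mul, Polynomial.aeval_X, Polynomial.aeval_C,
      Algebra.algebraMap_eq_smul_one] at h1
    rw [← h1, Matrix.mul_add, Matrix.mul_smul, Matrix.mul_one] at hBq
    have h2 : D = (-(q.coeff 0)⁻¹) • Polynomial.aeval B q.divX := by
      rw [hD, map_mul, Polynomial.aeval_C, Algebra.algebraMap_eq_smul_one, Matrix.smul_mul,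
        Matrix.one_mul]
    rw [h2, Matrix.mul_smul, Matrix.smul_mul, Matrix.mul_assoc, eq_neg_of_add_eq_zero_left hBq,
      smul_neg, neg_smul, neg_neg, smul_smul, inv_mul_cancel₀ hq0, one_smul]
  have hcancel : ∀ C : Matrix (Fin n) (Fin n) ℍ[ℝ], B * C = 0 → A * C = 0 := by
    intro C h
    refine eq_zero_of_conjTranspose_mul_self ?_
    rw [Matrix.conjTranspose_mul, Matrix.mul_assoc, ← Matrix.mul_assoc Aᴴ, ← hB, h,
      Matrix.mul_zero]
  have hABDB : A * (D * B * D * B) = A := by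
    have h1 : A * (D * B * D * B - 1) = 0 := by
      apply hcancel
      have : B * (D * B * D * B - 1) = B * D * B * D * B - B := by noncomm_ring
      rw [this, hBDB, hBDB, sub_self]
    rwa [Matrix.mul_sub, Matrix.mul_one, sub_eq_zero] at h1
  have hEH : (D * B * D)ᴴ = D * B * D := by
    simp only [Matrix.conjTranspose_mul, hDH, hBH, Matrix.mul_assoc]
  refine ⟨D * B * D * Aᴴ, ?_, ?_, ?_, ?_⟩
  · calc A * (D * B * D * Aᴴ) * A = A * (D * B * D * B) := by simp only [hB, Matrix.mul_assoc]
      _ = A := hABDB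
  · calc D * B * D * Aᴴ * A * (D * B * D * Aᴴ) = D * (B * D * B) * D * B * D * Aᴴ := by
          simp only [hB, Matrix.mul_assoc]
      _ = D * B * D * B * D * Aᴴ := by rw [hBDB]
      _ = D * (B * D * B) * D * Aᴴ := by simp only [Matrix.mul_assoc]
      _ = D * B * D * Aᴴ := by rw [hBDB]
  · rw [Matrix.conjTranspose_mul, Matrix.conjTranspose_mul, Matrix.conjTranspose_conjTranspose,
      hEH, Matrix.mul_assoc]
  · have h1 : D * B * D * Aᴴ * A = D * B * D * B := by simp only [hB, Matrix.mul_assoc]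
    have h2 : D * B * D * B = D * B := by
      rw [Matrix.mul_assoc, Matrix.mul_assoc, ← Matrix.mul_assoc B D B, hBDB]
    rw [h1, h2, Matrix.conjTranspose_mul, hDH, hBH, hcomm]


/-- The Moore--Penrose inverse `A†` of a quaternion matrix. -/
noncomputable def pinv {m n : ℕ} (A : Matrix (Fin m) (Fin n) ℍ[ℝ]) :
    Matrix (Fin n) (Fin m) ℍ[ℝ] :=
  Classical.choose (exists_isMoorePenrose A)

theorem isMoorePenrose_pinv {m n : ℕ} (A : Matrix (Fin m) (Fin n) ℍ[ℝ]) :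
    IsMoorePenrose A (pinv A) :=
  Classical.choose_spec (exists_isMoorePenrose A)

theorem IsMoorePenrose.eq_pinv {m n : ℕ} {A : Matrix (Fin m) (Fin n) ℍ[ℝ]}
    {X : Matrix (Fin n) (Fin m) ℍ[ℝ]} (hX : IsMoorePenrose A X) : X = pinv A := by
  have hY := isMoorePenrose_pinv A
  set Y := pinv A
  have h1 : A * X = A * Y := by
    calc A * X = (A * X)ᴴ := hX.left_hermitian.symm
      _ = ((A * Y) * (A * X))ᴴ := by rw [← Matrix.mul_assoc (A * Y) A X, hY.mul_mul_self]
      _ = A * X * (A * Y) := by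
        rw [Matrix.conjTranspose_mul, hX.left_hermitian, hY.left_hermitian]
      _ = A * Y := by rw [← Matrix.mul_assoc, hX.mul_mul_self]
  have h2 : X * A = Y * A := by
    calc X * A = (X * A)ᴴ := hX.right_hermitian.symm
      _ = ((X * A) * (Y * A))ᴴ := by
        rw [Matrix.mul_assoc X A, ← Matrix.mul_assoc A Y A, hY.mul_mul_self]
      _ = Y * A * (X * A) := by
        rw [Matrix.conjTranspose_mul, hX.right_hermitian, hY.right_hermitian]
      _ = Y * A := by rw [Matrix.mul_assoc, ← Matrix.mul_assoc A X A, hX.mul_mul_self]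
  calc X = X * A * X := hX.self_mul_mul.symm
    _ = Y * (A * X) := by rw [h2, Matrix.mul_assoc]
    _ = Y := by rw [h1, ← Matrix.mul_assoc, hY.self_mul_mul]

/-- The range of a quaternion matrix: the set of right linear combinations `∑ⱼ vⱼ kⱼ` of its
columns `vⱼ`. -/
def matRange {m n : ℕ} (M : Matrix (Fin m) (Fin n) ℍ[ℝ]) : Set (Fin m → ℍ[ℝ]) :=
  Set.range fun k : Fin n → ℍ[ℝ] => M *ᵥ k

/-- The columns of `M` are right linearly independent. -/
def FullColumnRank {m n : ℕ} (M : Matrix (Fin m) (Fin n) ℍ[ℝ]) : Prop :=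
  ∀ k : Fin n → ℍ[ℝ], M *ᵥ k = 0 → k = 0

/-- `H` is a range-preserving rangefinder for the sketch `Y`. -/
def IsRangefinder {m s : ℕ} (H Y : Matrix (Fin m) (Fin s) ℍ[ℝ]) : Prop :=
  matRange H = matRange Y ∧ FullColumnRank H

/-- The second factor `X = (Ψ H)† W` returned by the QB stage of the one-pass algorithm. -/
noncomputable def qbFactor {m n s l : ℕ} (Ψ : Matrix (Fin l) (Fin m) ℍ[ℝ])
    (H : Matrix (Fin m) (Fin s) ℍ[ℝ]) (W : Matrix (Fin l) (Fin n) ℍ[ℝ]) :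
    Matrix (Fin s) (Fin n) ℍ[ℝ] :=
  pinv (Ψ * H) * W

/-- `A = U Σ V*` is a quaternion singular value decomposition of an `m × n` matrix (`n ≤ m`), with
`Σ = diag(σ₁, …, σₙ)` real, `σ₁ ≥ ⋯ ≥ σₙ ≥ 0`, `U` with orthonormal columns, and `V` unitary. -/
structure IsQSVD {m n : ℕ} (A : Matrix (Fin m) (Fin n) ℍ[ℝ]) (U : Matrix (Fin m) (Fin n) ℍ[ℝ])
    (σ : Fin n → ℝ) (V : Matrix (Fin n) (Fin n) ℍ[ℝ]) : Prop where
  left_orthonormal : Uᴴ * U = 1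
  right_unitary : Vᴴ * V = 1 ∧ V * Vᴴ = 1
  antitone : Antitone σ
  nonneg : ∀ j, 0 ≤ σ j
  eq_mul : A = U * (Matrix.diagonal σ).map (fun t : ℝ => (t : ℍ[ℝ])) * Vᴴ

/-- The trailing block `Σ₂` of `Σ = diag(σ)`, left after removing the leading `r × r` block. -/
def trailingBlock {n : ℕ} (r : ℕ) (σ : Fin n → ℝ) :
    Matrix {j : Fin n // r ≤ (j : ℕ)} {j : Fin n // r ≤ (j : ℕ)} ℝ :=
  (Matrix.diagonal σ).submatrix Subtype.val Subtype.val

/-- The four real coordinates of a quaternion, in the order `1, i, j, k`. -/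
def coord (q : ℍ[ℝ]) : Fin 4 → ℝ := ![q.re, q.imI, q.imJ, q.imK]

/-- All real coordinates of all entries of a quaternion matrix. -/
def realCoords {m n : ℕ} (M : Matrix (Fin m) (Fin n) ℍ[ℝ]) : Fin m × Fin n × Fin 4 → ℝ :=
  fun p => coord (M p.1 p.2.1) p.2.2

/-- A random quaternion matrix is standard Gaussian if the real coordinates of its entries are
i.i.d. standard normal random variables. -/
structure IsStdGaussian {S : Type*} [MeasurableSpace S] (P : Measure S) {m n : ℕ}
    (G : S → Matrix (Fin m) (Fin n) ℍ[ℝ]) : Prop where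
  law : ∀ p, HasLaw (fun ω => realCoords (G ω) p) (gaussianReal 0 1) P
  indep : iIndepFun (fun p ω => realCoords (G ω) p) P

/-- `f(n, m) = 4n / (4(m - n) + 2)`, with subtraction in `ℝ`. -/
noncomputable def gaussianFactor (n m : ℕ) : ℝ := 4 * (n : ℝ) / (4 * ((m : ℝ) - (n : ℝ)) + 2)

end QuaternionSketch

/-! The product `H X` depends only on the range of `H`: once `Ψ Y` has full column rank, replacing
`H` by `H R` with `R` invertible leaves `H (Ψ H)† Ψ A` unchanged. So `H` may be traded for `Y = A
Ω`, or for an orthonormal basis `Q` of the range of `Y`.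

The heart is `lintegral_reconstruction_error_le`, for a fixed orthonormal `Q`. With `B = (1 - Q Q*)
A`, Pythagoras gives an error `‖(Ψ Q)† Ψ B‖² + ‖B‖²`. The matrices `Ψ Q` and `Ψ B` are independent,
since they see orthogonal parts of `Ψ`, so averaging over the second part turns the first term into
`4 ‖(Ψ Q)†‖² ‖B‖²`. The squared norm of the pseudoinverse is bounded by the sum of the inverse
squared distances from each column of `Ψ Q` to the span of the others. Given the other columns, such
a distance is the norm of a Gaussian vector in real dimension at least `4 (l - s + 1)`, whose
inverse second moment is at most `1 / (4 (l - s) + 2)`. Summing over `s` columns produces the factor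
`1 + f(s, l)`.

The same estimate serves twice. The residual `‖(1 - Q Q*) A‖` is at most `‖Y Z - A‖` for every `Z`,
and one choice of `Z` makes `(Y Z - A)*` the error of reconstructing `A*` from the sketch `Ω* A*`
with the leading `r` right singular vectors as basis. Averaging over `Ω` therefore costs `1 + f(r,
s)` over the tail `‖Σ₂‖²`.

Most estimates use the lower Lebesgue integral and inequalities valid for arbitrary functions, so
measurability of the error matters only when passing to the Bochner integral. -/

namespace QuaternionSketch

open scoped ENNReal

/-! ### Quaternion matrices as a real inner product space. -/

section InnerProduct

variable {m n p q : ℕ}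

/-- The real inner product `Re tr (Mᴴ N)` on quaternion matrices. -/
noncomputable def frobInner (M N : Matrix (Fin m) (Fin n) ℍ[ℝ]) : ℝ :=
  ∑ i, ∑ j, inner ℝ (M i j) (N i j)

theorem frobenius_norm_sq (M : Matrix (Fin m) (Fin n) ℍ[ℝ]) :
    ‖M‖ ^ 2 = ∑ i, ∑ j, ‖M i j‖ ^ 2 := by
  rw [Matrix.frobenius_norm_def, ← Real.sqrt_eq_rpow, Real.sq_sqrt (by positivity)]
  simp

/-- Standard Gaussian measures live on real inner product spaces; this inner product induces the
Frobenius norm already in force. -/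
noncomputable instance : InnerProductSpace ℝ (Matrix (Fin m) (Fin n) ℍ[ℝ]) where
  inner := frobInner
  norm_sq_eq_re_inner M := by
    rw [frobenius_norm_sq]
    simp [frobInner]
  conj_inner_symm M N := by
    simp [frobInner, real_inner_comm]
  add_left M N K := by
    simp [frobInner, inner_add_left, Finset.sum_add_distrib]
  smul_left M N r := by
    simp only [frobInner, Matrix.smul_apply, inner_smul_left, Finset.mul_sum]

theorem inner_def (M N : Matrix (Fin m) (Fin n) ℍ[ℝ]) :
    inner ℝ M N = ∑ i, ∑ j, inner ℝ (M i j) (N i j) := rfl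

noncomputable instance : MeasurableSpace (Matrix (Fin m) (Fin n) ℍ[ℝ]) := borel _
instance : BorelSpace (Matrix (Fin m) (Fin n) ℍ[ℝ]) := ⟨rfl⟩
instance : @BorelSpace (Matrix (Fin m) (Fin n) ℍ[ℝ])
    (Matrix.frobeniusNormedAddCommGroup (m := Fin m) (n := Fin n)
      (α := ℍ[ℝ])).toPseudoMetricSpace.toUniformSpace.toTopologicalSpace _ := ⟨rfl⟩

theorem quaternion_inner_mul_left (a b c : ℍ[ℝ]) : inner ℝ (a * b) c = inner ℝ b (star a * c) := by
  simp only [Quaternion.inner_def, Quaternion.re_mul, Quaternion.re_star, Quaternion.imI_star,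
    Quaternion.imJ_star, Quaternion.imK_star, Quaternion.imI_mul, Quaternion.imJ_mul,
    Quaternion.imK_mul]
  ring

theorem quaternion_inner_mul_right (a b c : ℍ[ℝ]) :
    inner ℝ (a * b) c = inner ℝ a (c * star b) := by
  simp only [Quaternion.inner_def, Quaternion.re_mul, Quaternion.re_star, Quaternion.imI_star,
    Quaternion.imJ_star, Quaternion.imK_star, Quaternion.imI_mul, Quaternion.imJ_mul,
    Quaternion.imK_mul]
  ring

theorem inner_mul_left_matrix (C : Matrix (Fin p) (Fin m) ℍ[ℝ]) (M : Matrix (Fin m) (Fin n) ℍ[ℝ])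
    (N : Matrix (Fin p) (Fin n) ℍ[ℝ]) : inner ℝ (C * M) N = inner ℝ M (Cᴴ * N) := by
  simp only [inner_def, Matrix.mul_apply, sum_inner, inner_sum, Matrix.conjTranspose_apply,
    quaternion_inner_mul_left]
  calc _ = ∑ i, ∑ k, ∑ j, inner ℝ (M k j) (star (C i k) * N i j) :=
        Finset.sum_congr rfl fun i _ => Finset.sum_comm
    _ = _ := by
        rw [Finset.sum_comm]
        exact Finset.sum_congr rfl fun i _ => Finset.sum_comm

theorem inner_mul_right_matrix (M : Matrix (Fin m) (Fin n) ℍ[ℝ])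
    (B : Matrix (Fin n) (Fin q) ℍ[ℝ]) (N : Matrix (Fin m) (Fin q) ℍ[ℝ]) :
    inner ℝ (M * B) N = inner ℝ M (N * Bᴴ) := by
  simp only [inner_def, Matrix.mul_apply, sum_inner, inner_sum, Matrix.conjTranspose_apply,
    quaternion_inner_mul_right]
  exact Finset.sum_congr rfl fun i _ => Finset.sum_comm

theorem inner_conjTranspose (M N : Matrix (Fin m) (Fin n) ℍ[ℝ]) :
    inner ℝ Mᴴ Nᴴ = inner ℝ M N := by
  simp only [inner_def, Matrix.conjTranspose_apply]
  rw [Finset.sum_comm]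
  refine Finset.sum_congr rfl fun i _ => Finset.sum_congr rfl fun j _ => ?_
  simp [Quaternion.inner_def]

/-- Right multiplication by a matrix as a real-linear map. -/
noncomputable def mulRightL (m : ℕ) (B : Matrix (Fin n) (Fin q) ℍ[ℝ]) :
    Matrix (Fin m) (Fin n) ℍ[ℝ] →ₗ[ℝ] Matrix (Fin m) (Fin q) ℍ[ℝ] where
  toFun M := M * B
  map_add' M N := Matrix.add_mul M N B
  map_smul' r M := Matrix.smul_mul r M B

/-- Left multiplication by a matrix as a real-linear map. -/
noncomputable def mulLeftL (n : ℕ) (C : Matrix (Fin p) (Fin m) ℍ[ℝ]) :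
    Matrix (Fin m) (Fin n) ℍ[ℝ] →ₗ[ℝ] Matrix (Fin p) (Fin n) ℍ[ℝ] where
  toFun M := C * M
  map_add' M N := Matrix.mul_add C M N
  map_smul' r M := Matrix.mul_smul C r M

@[simp] theorem mulRightL_apply (B : Matrix (Fin n) (Fin q) ℍ[ℝ])
    (M : Matrix (Fin m) (Fin n) ℍ[ℝ]) : mulRightL m B M = M * B := rfl

@[simp] theorem mulLeftL_apply (C : Matrix (Fin p) (Fin m) ℍ[ℝ])
    (M : Matrix (Fin m) (Fin n) ℍ[ℝ]) : mulLeftL n C M = C * M := rfl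

/-- Left multiplication by an isometry preserves the norm. -/
theorem norm_isometry_mul {Q : Matrix (Fin p) (Fin m) ℍ[ℝ]} (hQ : Qᴴ * Q = 1)
    (M : Matrix (Fin m) (Fin n) ℍ[ℝ]) : ‖Q * M‖ = ‖M‖ := by
  rw [← sq_eq_sq₀ (norm_nonneg _) (norm_nonneg _), ← real_inner_self_eq_norm_sq,
    inner_mul_left_matrix, ← Matrix.mul_assoc, hQ, Matrix.one_mul, real_inner_self_eq_norm_sq]

theorem norm_mul_coisometry {Q : Matrix (Fin p) (Fin n) ℍ[ℝ]} (hQ : Qᴴ * Q = 1)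
    (M : Matrix (Fin m) (Fin n) ℍ[ℝ]) : ‖M * Qᴴ‖ = ‖M‖ := by
  rw [← sq_eq_sq₀ (norm_nonneg _) (norm_nonneg _), ← real_inner_self_eq_norm_sq,
    inner_mul_right_matrix, Matrix.conjTranspose_conjTranspose, Matrix.mul_assoc, hQ,
    Matrix.mul_one, real_inner_self_eq_norm_sq]

/-- Left multiplication by a Hermitian idempotent does not increase the norm. -/
theorem norm_proj_mul_le {E : Matrix (Fin m) (Fin m) ℍ[ℝ]} (hE : Eᴴ = E) (hE2 : E * E = E)
    (M : Matrix (Fin m) (Fin n) ℍ[ℝ]) : ‖E * M‖ ≤ ‖M‖ := by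
  have h : ‖E * M‖ ^ 2 = inner ℝ (E * M) M := by
    rw [← real_inner_self_eq_norm_sq, real_inner_comm, inner_mul_left_matrix, hE,
      ← Matrix.mul_assoc, hE2, real_inner_comm]
  have h2 := real_inner_le_norm (E * M) M
  by_contra! hlt
  nlinarith [norm_nonneg M, norm_nonneg (E * M)]

theorem norm_mul_proj_le {E : Matrix (Fin n) (Fin n) ℍ[ℝ]} (hE : Eᴴ = E) (hE2 : E * E = E)
    (M : Matrix (Fin m) (Fin n) ℍ[ℝ]) : ‖M * E‖ ≤ ‖M‖ := by
  have := norm_proj_mul_le hE hE2 Mᴴ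
  rwa [← Matrix.frobenius_norm_conjTranspose, Matrix.conjTranspose_mul,
    Matrix.conjTranspose_conjTranspose, hE, Matrix.frobenius_norm_conjTranspose] at this

end InnerProduct

/-! ### Openness of the units and continuity of inversion. -/

section Inverse

theorem isOpen_isUnit_of_finiteDimensional (R : Type*) [NormedRing R] [NormedAlgebra ℝ R]
    [FiniteDimensional ℝ R] : IsOpen {x : R | IsUnit x} := by
  have : CompleteSpace R := FiniteDimensional.complete ℝ R
  exact Units.isOpen

theorem continuousAt_inverse_of_finiteDimensional {R : Type*} [NormedRing R] [NormedAlgebra ℝ R]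
    [FiniteDimensional ℝ R] {x : R} (hx : IsUnit x) : ContinuousAt Ring.inverse x := by
  have : CompleteSpace R := FiniteDimensional.complete ℝ R
  obtain ⟨u, rfl⟩ := hx
  exact NormedRing.inverse_continuousAt u

variable {n : ℕ}

/-- Only the topology enters the statement, so any algebra norm inducing it will do; the `ℓ∞`
operator norm is used. -/
theorem isOpen_isUnit_matrix :
    IsOpen {M : Matrix (Fin n) (Fin n) ℍ[ℝ] | IsUnit M} :=
  @isOpen_isUnit_of_finiteDimensional _ Matrix.linftyOpNormedRing Matrix.linftyOpNormedAlgebra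
    inferInstance

theorem continuousAt_inverse_matrix {M : Matrix (Fin n) (Fin n) ℍ[ℝ]} (hM : IsUnit M) :
    ContinuousAt Ring.inverse M :=
  @continuousAt_inverse_of_finiteDimensional _ Matrix.linftyOpNormedRing
    Matrix.linftyOpNormedAlgebra inferInstance _ hM

end Inverse

/-! ### Linear images and orthogonal splittings of Gaussian measures. -/

section Gaussian

variable {E F : Type*} [NormedAddCommGroup E] [InnerProductSpace ℝ E] [FiniteDimensional ℝ E]
  [MeasurableSpace E] [BorelSpace E]
  [NormedAddCommGroup F] [InnerProductSpace ℝ F] [FiniteDimensional ℝ F]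
  [MeasurableSpace F] [BorelSpace F]

/-- A linear map whose adjoint is isometric maps the standard Gaussian to the standard Gaussian. -/
theorem stdGaussian_map_coisometry (L : E →ₗ[ℝ] F) (L' : F → E)
    (hadj : ∀ x t, inner ℝ (L x) t = inner ℝ x (L' t)) (hnorm : ∀ t, ‖L' t‖ = ‖t‖) :
    (stdGaussian E).map L = stdGaussian F := by
  have hL : Measurable L := L.continuous_of_finiteDimensional.measurable
  have : IsProbabilityMeasure ((stdGaussian E).map L) :=
    Measure.isProbabilityMeasure_map hL.aemeasurable
  have : CompleteSpace F := FiniteDimensional.complete ℝ F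
  refine Measure.ext_of_charFun (funext fun t => ?_)
  rw [charFun_stdGaussian, ← hnorm t, ← charFun_stdGaussian (L' t), charFun_apply, charFun_apply,
    integral_map hL.aemeasurable (by fun_prop)]
  simp_rw [hadj]

/-- Splitting a standard Gaussian along an orthogonal projection. -/
theorem stdGaussian_prod_map_split (A : E →ₗ[ℝ] E)
    (hsymm : ∀ x t, inner ℝ (A x) t = inner ℝ x (A t)) (hidem : ∀ x, A (A x) = A x) :
    ((stdGaussian E).prod (stdGaussian E)).map (fun z => A z.1 + (z.2 - A z.2)) =
      stdGaussian E := by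
  have hA : Measurable A := A.continuous_of_finiteDimensional.measurable
  have hm : Measurable (fun z : E × E => A z.1 + (z.2 - A z.2)) := by fun_prop
  have : IsProbabilityMeasure (((stdGaussian E).prod (stdGaussian E)).map
      (fun z => A z.1 + (z.2 - A z.2))) := Measure.isProbabilityMeasure_map hm.aemeasurable
  have : CompleteSpace E := FiniteDimensional.complete ℝ E
  refine Measure.ext_of_charFun (funext fun t => ?_)
  -- Pythagoras for the projection factors the characteristic function, which is what independence
  -- of the two components amounts to.
  have key : ‖A t‖ ^ 2 + ‖t - A t‖ ^ 2 = ‖t‖ ^ 2 := by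
    have h1 : inner ℝ (A t) (t - A t) = 0 := by
      rw [hsymm, map_sub, hidem, sub_self, inner_zero_right]
    have := norm_add_sq_real (A t) (t - A t)
    rw [h1] at this
    rw [add_sub_cancel] at this
    linarith
  have h2 : charFun (stdGaussian E) t =
      charFun (stdGaussian E) (A t) * charFun (stdGaussian E) (t - A t) := by
    rw [charFun_stdGaussian, charFun_stdGaussian, charFun_stdGaussian, ← Complex.exp_add]
    congr 1
    rw [← Complex.ofReal_pow, ← key]
    push_cast
    ring
  rw [h2, charFun_apply, integral_map hm.aemeasurable (by fun_prop), charFun_apply, charFun_apply,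
    ← integral_prod_mul]
  refine integral_congr_ae (Filter.Eventually.of_forall fun z => ?_)
  simp only [← Complex.exp_add]
  congr 1
  rw [inner_add_left, hsymm, inner_sub_left, hsymm, inner_sub_right]
  push_cast
  ring

/-- Both the image measure and the product measure lose at most in this direction for an arbitrary
`f`, so integrands containing `pinv` need no measurability proof here. -/
theorem lintegral_stdGaussian_le_split (A : E →ₗ[ℝ] E)
    (hsymm : ∀ x t, inner ℝ (A x) t = inner ℝ x (A t)) (hidem : ∀ x, A (A x) = A x)
    (f : E → ℝ≥0∞) :
    ∫⁻ x, f x ∂stdGaussian E ≤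
      ∫⁻ x, ∫⁻ y, f (A x + (y - A y)) ∂stdGaussian E ∂stdGaussian E := by
  rw [← stdGaussian_prod_map_split A hsymm hidem]
  exact (lintegral_map_le _ _).trans (by
    rw [stdGaussian_prod_map_split A hsymm hidem]
    exact lintegral_prod_le _)

theorem stdGaussian_map_inner (t : E) :
    (stdGaussian E).map (fun x => inner ℝ x t) = gaussianReal 0 (‖t‖₊ ^ 2) := by
  have hm : Measurable (fun x : E => inner ℝ x t) := by fun_prop
  have : IsProbabilityMeasure ((stdGaussian E).map (fun x => inner ℝ x t)) :=
    Measure.isProbabilityMeasure_map hm.aemeasurable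
  refine Measure.ext_of_charFun (funext fun u => ?_)
  rw [charFun_gaussianReal, charFun_apply, integral_map hm.aemeasurable (by fun_prop)]
  have h := charFun_stdGaussian (u • t)
  rw [charFun_apply] at h
  simp only [inner_smul_right, norm_smul] at h
  simp only [RCLike.inner_apply, conj_trivial]
  rw [h]
  congr 1
  simp [mul_pow, ← Complex.ofReal_pow]
  ring

theorem lintegral_inner_sq_stdGaussian (t : E) :
    ∫⁻ x, ENNReal.ofReal (inner ℝ x t ^ 2) ∂stdGaussian E = ENNReal.ofReal (‖t‖ ^ 2) := by
  have hm : Measurable (fun x : E => inner ℝ x t) := by fun_prop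
  have h1 : ∫⁻ x, ENNReal.ofReal (inner ℝ x t ^ 2) ∂stdGaussian E =
      ∫⁻ y, ENNReal.ofReal (y ^ 2) ∂gaussianReal 0 (‖t‖₊ ^ 2) := by
    rw [← stdGaussian_map_inner t, lintegral_map (by fun_prop) hm]
  have h2 : MemLp id 2 (gaussianReal 0 (‖t‖₊ ^ 2)) := memLp_id_gaussianReal 2
  rw [h1, ← ofReal_integral_eq_lintegral_ofReal (by simpa using h2.integrable_sq)
    (Filter.Eventually.of_forall fun y => by positivity)]
  have h3 := variance_id_gaussianReal (μ := 0) (v := ‖t‖₊ ^ 2)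
  rw [variance_eq_integral (by fun_prop)] at h3
  simp only [id_eq, integral_id_gaussianReal, sub_zero] at h3
  rw [h3]
  simp

/-- Laplace transform of the square of a standard Gaussian variable. -/
theorem integral_exp_neg_sq_gaussianReal {t : ℝ} (ht : 0 < t) :
    ∫ x, Real.exp (-t * x ^ 2) ∂gaussianReal 0 1 = (1 + 2 * t) ^ (-(1 / 2 : ℝ)) := by
  rw [integral_gaussianReal_eq_integral_smul one_ne_zero]
  have h1 : ∀ x : ℝ, gaussianPDFReal 0 1 x • Real.exp (-t * x ^ 2) =
      (Real.sqrt (2 * Real.pi))⁻¹ * Real.exp (-(t + 1 / 2) * x ^ 2) := by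
    intro x
    simp only [gaussianPDFReal, smul_eq_mul, NNReal.coe_one, mul_one, mul_assoc, ← Real.exp_add]
    congr 2
    ring
  simp_rw [h1]
  rw [integral_const_mul, integral_gaussian, ← Real.sqrt_inv, ← Real.sqrt_mul (by positivity),
    Real.rpow_neg (by positivity), ← Real.sqrt_eq_rpow, ← Real.sqrt_inv]
  congr 1
  have := Real.pi_pos
  field_simp
  ring

end Gaussian

/-! ### Inverse second moments of Gaussian vectors. -/

section InverseMoment

variable {E F : Type*} [NormedAddCommGroup E] [InnerProductSpace ℝ E] [FiniteDimensional ℝ E]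
  [MeasurableSpace E] [BorelSpace E]
  [NormedAddCommGroup F] [InnerProductSpace ℝ F] [FiniteDimensional ℝ F]
  [MeasurableSpace F] [BorelSpace F]

theorem integral_exp_neg_norm_sq_stdGaussian {t : ℝ} (ht : 0 < t) :
    ∫ x, Real.exp (-t * ‖x‖ ^ 2) ∂stdGaussian F =
      ((1 + 2 * t) ^ (-(1 / 2 : ℝ))) ^ Module.finrank ℝ F := by
  set b := stdOrthonormalBasis ℝ F
  rw [stdGaussian_eq_map_pi_orthonormalBasis b, integral_map (Measurable.aemeasurable (by fun_prop))
    (by fun_prop)]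
  have h1 : ∀ x : Fin (Module.finrank ℝ F) → ℝ, Real.exp (-t * ‖∑ i, x i • b i‖ ^ 2) =
      ∏ i, Real.exp (-t * x i ^ 2) := by
    intro x
    rw [← Real.exp_sum, ← Finset.mul_sum]
    congr 2
    rw [← real_inner_self_eq_norm_sq, b.orthonormal.inner_sum]
    simp [sq]
  simp_rw [h1]
  rw [integral_fintype_prod_eq_prod (fun _ y => Real.exp (-t * y ^ 2))]
  rw [Finset.prod_const, integral_exp_neg_sq_gaussianReal ht, Finset.card_univ, Fintype.card_fin]

/-- Turns an inverse square into Laplace transforms, which factor over Gaussian coordinates. At `a =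
0` both sides are infinite, so no null set has to be removed. -/
theorem inv_ofReal_eq_lintegral_exp {a : ℝ} (ha : 0 ≤ a) :
    (ENNReal.ofReal a)⁻¹ = ∫⁻ t in Set.Ioi (0 : ℝ), ENNReal.ofReal (Real.exp (-t * a)) := by
  rcases ha.eq_or_lt with rfl | ha
  · simp
  · have h1 : ∀ t : ℝ, -t * a = (-a) * t := fun t => by ring
    simp_rw [h1]
    rw [← ofReal_integral_eq_lintegral_ofReal (integrableOn_exp_mul_Ioi (by linarith) 0)
      (Filter.Eventually.of_forall fun t => by positivity),
      integral_exp_mul_Ioi (by linarith), ← ENNReal.ofReal_inv_of_pos ha]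
    simp

theorem lintegral_inv_pow_Ioi (k : ℕ) :
    ∫⁻ t in Set.Ioi (0 : ℝ), ENNReal.ofReal (((1 + 2 * t)⁻¹) ^ (k + 2)) =
      ENNReal.ofReal (1 / (2 * (k + 1))) := by
  have hd : ∀ t ∈ Set.Ici (0 : ℝ), HasDerivAt
      (fun t : ℝ => -((1 + 2 * t)⁻¹) ^ (k + 1) / (2 * (k + 1))) (((1 + 2 * t)⁻¹) ^ (k + 2)) t := by
    intro t ht
    have h0 : (1 + 2 * t) ≠ 0 := by
      have : (0 : ℝ) ≤ t := ht
      positivity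
    have h1 : HasDerivAt (fun t : ℝ => 1 + 2 * t) 2 t := by
      simpa using ((hasDerivAt_id t).const_mul 2).const_add 1
    refine (((h1.fun_inv h0).fun_pow (k + 1)).fun_neg.div_const (2 * ((k : ℝ) + 1))).congr_deriv ?_
    have : (k : ℝ) + 1 ≠ 0 := by positivity
    simp only [Nat.add_sub_cancel]
    push_cast
    rw [pow_add]
    field_simp
  have hpos : ∀ t ∈ Set.Ioi (0 : ℝ), 0 ≤ ((1 + 2 * t)⁻¹) ^ (k + 2) := by
    intro t ht
    have : (0 : ℝ) < t := ht
    positivity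
  have hlim : Filter.Tendsto (fun t : ℝ => -((1 + 2 * t)⁻¹) ^ (k + 1) / (2 * (k + 1)))
      Filter.atTop (nhds (-0 ^ (k + 1) / (2 * (k + 1)))) := by
    refine Filter.Tendsto.div_const (Filter.Tendsto.neg (Filter.Tendsto.pow ?_ _)) _
    refine tendsto_inv_atTop_zero.comp (Filter.tendsto_atTop_add_const_left _ _ ?_)
    exact Filter.tendsto_id.const_mul_atTop (by norm_num)
  rw [← ofReal_integral_eq_lintegral_ofReal (integrableOn_Ioi_deriv_of_nonneg' hd hpos hlim)
    ((ae_restrict_iff' measurableSet_Ioi).2 (Filter.Eventually.of_forall hpos)),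
    integral_Ioi_of_hasDerivAt_of_nonneg' hd hpos hlim]
  congr 1
  have : (k : ℝ) + 1 ≠ 0 := by positivity
  simp
  field_simp

/-- The inverse second moment of a standard Gaussian vector in dimension at least `2 (k + 2)`. -/
theorem lintegral_inv_norm_sq_stdGaussian_le (k : ℕ) (hF : 2 * (k + 2) ≤ Module.finrank ℝ F) :
    ∫⁻ x, (ENNReal.ofReal (‖x‖ ^ 2))⁻¹ ∂stdGaussian F ≤ ENNReal.ofReal (1 / (2 * (k + 1))) := by
  simp_rw [fun x : F => inv_ofReal_eq_lintegral_exp (sq_nonneg ‖x‖)]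
  rw [lintegral_lintegral_swap (by fun_prop), ← lintegral_inv_pow_Ioi]
  refine setLIntegral_mono' measurableSet_Ioi fun t (ht : 0 < t) => ?_
  have hbd : ∀ x : F, ‖Real.exp (-t * ‖x‖ ^ 2)‖ ≤ 1 := by
    intro x
    rw [Real.norm_eq_abs, Real.abs_exp, Real.exp_le_one_iff]
    nlinarith [sq_nonneg ‖x‖]
  rw [← ofReal_integral_eq_lintegral_ofReal
    (Integrable.of_bound (by fun_prop) 1 (Filter.Eventually.of_forall hbd))
    (Filter.Eventually.of_forall fun t => by positivity),
    integral_exp_neg_norm_sq_stdGaussian ht]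
  refine ENNReal.ofReal_le_ofReal ?_
  have h1 : (0 : ℝ) ≤ (1 + 2 * t) ^ (-(1 / 2 : ℝ)) := by positivity
  have h2 : (1 + 2 * t) ^ (-(1 / 2 : ℝ)) ≤ 1 :=
    Real.rpow_le_one_of_one_le_of_nonpos (by linarith) (by norm_num)
  -- The base is at most `1`, so the dimension can be lowered to `2 (k + 2)`, leaving the integer
  -- power `k + 2` of `(1 + 2t)⁻¹`.
  refine (pow_le_pow_of_le_one h1 h2 hF).trans_eq ?_
  rw [pow_mul, ← Real.rpow_natCast ((1 + 2 * t) ^ (-(1 / 2 : ℝ))), ← Real.rpow_mul (by positivity)]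
  norm_num
  rw [Real.rpow_neg_one]
  simp

/-- The inverse second moment of an orthogonal projection of a standard Gaussian vector. -/
theorem lintegral_inv_norm_sq_proj_le (N : E →ₗ[ℝ] E)
    (hsymm : ∀ x t, inner ℝ (N x) t = inner ℝ x (N t)) (hidem : ∀ x, N (N x) = N x)
    (k : ℕ) (hN : 2 * (k + 2) ≤ Module.finrank ℝ (LinearMap.range N)) :
    ∫⁻ x, (ENNReal.ofReal (‖N x‖ ^ 2))⁻¹ ∂stdGaussian E ≤ ENNReal.ofReal (1 / (2 * (k + 1))) := by
  have h := stdGaussian_map_coisometry N.rangeRestrict (fun t => (t : E)) (by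
    rintro x ⟨t, u, rfl⟩
    change inner ℝ (N x) (N u) = inner ℝ x (N u)
    rw [hsymm, hidem]) (fun t => rfl)
  have hm : Measurable N.rangeRestrict :=
    N.rangeRestrict.continuous_of_finiteDimensional.measurable
  refine le_trans (le_of_eq ?_) (lintegral_inv_norm_sq_stdGaussian_le k hN)
  rw [← h, lintegral_map (by fun_prop) hm]
  rfl

end InverseMoment

/-! ### Second moments of two-sided products with a Gaussian matrix. -/

section SecondMoment

variable {m n p q : ℕ}

/-- The real basis `1, i, j, k` of the quaternions. -/
def quaternionUnit : Fin 4 → ℍ[ℝ] := ![⟨1, 0, 0, 0⟩, ⟨0, 1, 0, 0⟩, ⟨0, 0, 1, 0⟩, ⟨0, 0, 0, 1⟩]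

theorem inner_quaternionUnit (x : ℍ[ℝ]) (c : Fin 4) :
    inner ℝ x (quaternionUnit c) = coord x c := by
  have h : ∀ e : ℍ[ℝ], inner ℝ x e = x.re * e.re + x.imI * e.imI + x.imJ * e.imJ + x.imK * e.imK :=
    fun e => by
      simp only [Quaternion.inner_def, Quaternion.re_mul, Quaternion.re_star, Quaternion.imI_star,
        Quaternion.imJ_star, Quaternion.imK_star]
      ring
  rw [h]
  fin_cases c <;> simp [quaternionUnit, coord]

theorem norm_quaternionUnit (c : Fin 4) : ‖quaternionUnit c‖ = 1 := by
  rw [← sq_eq_sq₀ (norm_nonneg _) zero_le_one, ← real_inner_self_eq_norm_sq, inner_quaternionUnit]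
  fin_cases c <;> simp [quaternionUnit, coord]

theorem norm_sq_eq_sum_coord (x : ℍ[ℝ]) : ‖x‖ ^ 2 = ∑ c, coord x c ^ 2 := by
  rw [sq, ← Quaternion.normSq_eq_norm_mul_self, Quaternion.normSq_def']
  simp [Fin.sum_univ_four, coord]

theorem mul_apply_inner (C : Matrix (Fin p) (Fin m) ℍ[ℝ]) (B : Matrix (Fin n) (Fin q) ℍ[ℝ])
    (X : Matrix (Fin m) (Fin n) ℍ[ℝ]) (a : Fin p) (b : Fin q) (e : ℍ[ℝ]) :
    inner ℝ ((C * X * B) a b) e =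
      inner ℝ X (Matrix.of fun i j => star (C a i) * e * star (B j b)) := by
  rw [Matrix.mul_assoc]
  simp only [Matrix.mul_apply, inner_def, Matrix.of_apply, sum_inner]
  refine Finset.sum_congr rfl fun i _ => ?_
  rw [quaternion_inner_mul_left, sum_inner]
  exact Finset.sum_congr rfl fun j _ => quaternion_inner_mul_right _ _ _

theorem norm_sq_rankOne (C : Matrix (Fin p) (Fin m) ℍ[ℝ]) (B : Matrix (Fin n) (Fin q) ℍ[ℝ])
    (a : Fin p) (b : Fin q) {e : ℍ[ℝ]} (he : ‖e‖ = 1) :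
    ‖(Matrix.of fun i j => star (C a i) * e * star (B j b) : Matrix (Fin m) (Fin n) ℍ[ℝ])‖ ^ 2 =
      (∑ i, ‖C a i‖ ^ 2) * ∑ j, ‖B j b‖ ^ 2 := by
  rw [frobenius_norm_sq, Finset.sum_mul_sum]
  simp [he, mul_pow]

/-- Each real coordinate of an entry of `C X B` is the inner product of `X` with a rank-one matrix,
hence a centred Gaussian whose variance is the squared norm of that matrix. The `4` counts the
coordinates of a quaternion. -/
theorem lintegral_norm_sq_mul_mul (C : Matrix (Fin p) (Fin m) ℍ[ℝ])
    (B : Matrix (Fin n) (Fin q) ℍ[ℝ]) :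
    ∫⁻ X, ENNReal.ofReal (‖C * X * B‖ ^ 2) ∂stdGaussian (Matrix (Fin m) (Fin n) ℍ[ℝ]) =
      ENNReal.ofReal (4 * ‖C‖ ^ 2 * ‖B‖ ^ 2) := by
  have h0 : ∀ (a : Fin p) (b : Fin q) (c : Fin 4) (X : Matrix (Fin m) (Fin n) ℍ[ℝ]),
      coord ((C * X * B) a b) c = inner ℝ X
        (Matrix.of fun i j => star (C a i) * quaternionUnit c * star (B j b)) := by
    intro a b c X
    rw [← mul_apply_inner, inner_quaternionUnit]
  have hm : ∀ (a : Fin p) (b : Fin q) (c : Fin 4),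
      Measurable fun X : Matrix (Fin m) (Fin n) ℍ[ℝ] =>
        ENNReal.ofReal (coord ((C * X * B) a b) c ^ 2) := by
    intro a b c
    simp_rw [h0]
    fun_prop
  have h1 : ∀ (a : Fin p) (b : Fin q) (c : Fin 4),
      ∫⁻ X, ENNReal.ofReal (coord ((C * X * B) a b) c ^ 2)
        ∂stdGaussian (Matrix (Fin m) (Fin n) ℍ[ℝ]) =
      ENNReal.ofReal ((∑ i, ‖C a i‖ ^ 2) * ∑ j, ‖B j b‖ ^ 2) := by
    intro a b c
    simp_rw [h0]
    rw [lintegral_inner_sq_stdGaussian, norm_sq_rankOne C B a b (norm_quaternionUnit c)]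
  have h2 : ∀ X : Matrix (Fin m) (Fin n) ℍ[ℝ], ENNReal.ofReal (‖C * X * B‖ ^ 2) =
      ∑ a, ∑ b, ∑ c, ENNReal.ofReal (coord ((C * X * B) a b) c ^ 2) := by
    intro X
    rw [frobenius_norm_sq, ENNReal.ofReal_sum_of_nonneg (fun _ _ => by positivity)]
    refine Finset.sum_congr rfl fun a _ => ?_
    rw [ENNReal.ofReal_sum_of_nonneg (fun _ _ => by positivity)]
    refine Finset.sum_congr rfl fun b _ => ?_
    rw [norm_sq_eq_sum_coord, ENNReal.ofReal_sum_of_nonneg (fun _ _ => by positivity)]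
  calc _ = ∑ a : Fin p, ∑ b : Fin q, ∑ c : Fin 4,
        ENNReal.ofReal ((∑ i, ‖C a i‖ ^ 2) * ∑ j, ‖B j b‖ ^ 2) := by
        simp_rw [h2]
        rw [lintegral_finsetSum _ fun a _ => Finset.measurable_sum _ fun b _ =>
          Finset.measurable_sum _ fun c _ => hm a b c]
        refine Finset.sum_congr rfl fun a _ => ?_
        rw [lintegral_finsetSum _ fun b _ => Finset.measurable_sum _ fun c _ => hm a b c]
        refine Finset.sum_congr rfl fun b _ => ?_
        rw [lintegral_finsetSum _ fun c _ => hm a b c]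
        exact Finset.sum_congr rfl fun c _ => h1 a b c
    _ = ENNReal.ofReal (∑ a : Fin p, ∑ b : Fin q, ∑ c : Fin 4,
        (∑ i, ‖C a i‖ ^ 2) * ∑ j, ‖B j b‖ ^ 2) := by
        rw [ENNReal.ofReal_sum_of_nonneg (fun _ _ => by positivity)]
        refine Finset.sum_congr rfl fun a _ => ?_
        rw [ENNReal.ofReal_sum_of_nonneg (fun _ _ => by positivity)]
        refine Finset.sum_congr rfl fun b _ => ?_
        rw [ENNReal.ofReal_sum_of_nonneg (fun _ _ => by positivity)]
    _ = _ := by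
        congr 1
        rw [frobenius_norm_sq C, frobenius_norm_sq B,
          Finset.sum_comm (f := fun i j => ‖B i j‖ ^ 2), mul_assoc, Finset.sum_mul_sum,
          Finset.mul_sum]
        refine Finset.sum_congr rfl fun a _ => ?_
        rw [Finset.mul_sum]
        simp

end SecondMoment

/-! ### Full column rank, pseudoinverses and change of basis. -/

section LinearAlgebra

variable {m n p q l s : ℕ}

theorem FullColumnRank.eq_zero_of_mul {G : Matrix (Fin m) (Fin n) ℍ[ℝ]} (hG : FullColumnRank G)
    {M : Matrix (Fin n) (Fin q) ℍ[ℝ]} (h : G * M = 0) : M = 0 := by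
  ext1 i j
  refine congrFun (hG (fun i => M i j) ?_) i
  ext1 x
  exact congrFun (congrFun h x) j

theorem fullColumnRank_of_leftInverse {G : Matrix (Fin m) (Fin n) ℍ[ℝ]}
    {W : Matrix (Fin n) (Fin m) ℍ[ℝ]} (h : W * G = 1) : FullColumnRank G := by
  intro k hk
  rw [← Matrix.one_mulVec k, ← h, ← Matrix.mulVec_mulVec, hk, Matrix.mulVec_zero]

theorem FullColumnRank.pinv_mul {G : Matrix (Fin m) (Fin n) ℍ[ℝ]} (hG : FullColumnRank G) :
    pinv G * G = 1 := by
  refine sub_eq_zero.1 (hG.eq_zero_of_mul ?_)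
  rw [Matrix.mul_sub, ← Matrix.mul_assoc, (isMoorePenrose_pinv G).mul_mul_self, Matrix.mul_one,
    sub_self]

theorem conjTranspose_mul_mul_pinv (G : Matrix (Fin m) (Fin n) ℍ[ℝ]) :
    Gᴴ * (G * pinv G) = Gᴴ := by
  rw [← (isMoorePenrose_pinv G).left_hermitian, ← Matrix.conjTranspose_mul,
    (isMoorePenrose_pinv G).mul_mul_self]

theorem FullColumnRank.isUnit {G : Matrix (Fin m) (Fin n) ℍ[ℝ]} (hG : FullColumnRank G) :
    IsUnit (Gᴴ * G) := by
  have h1 : Gᴴ * G * (pinv G * (pinv G)ᴴ) = 1 := by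
    rw [Matrix.mul_assoc, ← Matrix.mul_assoc G, ← Matrix.mul_assoc, conjTranspose_mul_mul_pinv,
      ← Matrix.conjTranspose_mul, hG.pinv_mul, Matrix.conjTranspose_one]
  have h2 : pinv G * (pinv G)ᴴ * (Gᴴ * G) = 1 := by
    have := congrArg Matrix.conjTranspose h1
    simpa [Matrix.conjTranspose_mul, Matrix.mul_assoc] using this
  exact ⟨⟨_, _, h1, h2⟩, rfl⟩

theorem fullColumnRank_of_isUnit {G : Matrix (Fin m) (Fin n) ℍ[ℝ]} (h : IsUnit (Gᴴ * G)) :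
    FullColumnRank G := by
  refine fullColumnRank_of_leftInverse (W := Ring.inverse (Gᴴ * G) * Gᴴ) ?_
  rw [Matrix.mul_assoc, Ring.inverse_mul_cancel _ h]

theorem FullColumnRank.pinv_eq {G : Matrix (Fin m) (Fin n) ℍ[ℝ]} (hG : FullColumnRank G) :
    pinv G = Ring.inverse (Gᴴ * G) * Gᴴ := by
  have h : Ring.inverse (Gᴴ * G) * (Gᴴ * (G * pinv G)) = pinv G := by
    rw [← Matrix.mul_assoc Gᴴ, ← Matrix.mul_assoc, Ring.inverse_mul_cancel _ hG.isUnit,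
      Matrix.one_mul]
  rw [← h, conjTranspose_mul_mul_pinv]

/-- `pinv G` is `W` times the orthogonal projection `G * pinv G`, and projections do not increase
the norm. -/
theorem norm_pinv_le_of_leftInverse {G : Matrix (Fin m) (Fin n) ℍ[ℝ]}
    {W : Matrix (Fin n) (Fin m) ℍ[ℝ]} (h : W * G = 1) : ‖pinv G‖ ≤ ‖W‖ := by
  have hp := isMoorePenrose_pinv G
  have h1 : pinv G = W * (G * pinv G) := by rw [← Matrix.mul_assoc, h, Matrix.one_mul]
  rw [h1]
  refine norm_mul_proj_le hp.left_hermitian ?_ W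
  rw [← Matrix.mul_assoc, hp.mul_mul_self]

/-- Replacing a basis of the sketched range by another one does not change the reconstruction. -/
theorem mul_pinv_mul_of_isUnit {Q : Matrix (Fin m) (Fin s) ℍ[ℝ]} {Ψ : Matrix (Fin l) (Fin m) ℍ[ℝ]}
    (hQ : FullColumnRank (Ψ * Q)) {R R' : Matrix (Fin s) (Fin s) ℍ[ℝ]} (h1 : R * R' = 1)
    (h2 : R' * R = 1) : Q * R * pinv (Ψ * (Q * R)) = Q * pinv (Ψ * Q) := by
  have hp := isMoorePenrose_pinv (Ψ * Q)
  have hW := hQ.pinv_mul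
  set M := Ψ * Q
  have ha : M * R * (R' * pinv M) = M * pinv M := by
    rw [Matrix.mul_assoc, ← Matrix.mul_assoc R, h1, Matrix.one_mul]
  have hb : R' * pinv M * (M * R) = 1 := by
    rw [Matrix.mul_assoc, ← Matrix.mul_assoc (pinv M), hW, Matrix.one_mul, h2]
  have : IsMoorePenrose (M * R) (R' * pinv M) := by
    refine ⟨?_, ?_, ?_, ?_⟩
    · rw [Matrix.mul_assoc, hb, Matrix.mul_one]
    · rw [hb, Matrix.one_mul]
    · rw [ha, hp.left_hermitian]
    · rw [hb, Matrix.conjTranspose_one]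
  rw [← Matrix.mul_assoc Ψ, ← this.eq_pinv, Matrix.mul_assoc, ← Matrix.mul_assoc R, h1,
    Matrix.one_mul]

theorem FullColumnRank.mul_isUnit {G : Matrix (Fin m) (Fin s) ℍ[ℝ]} (hG : FullColumnRank G)
    {R R' : Matrix (Fin s) (Fin s) ℍ[ℝ]} (h2 : R' * R = 1) : FullColumnRank (G * R) := by
  refine fullColumnRank_of_leftInverse (W := R' * pinv G) ?_
  rw [Matrix.mul_assoc, ← Matrix.mul_assoc (pinv G), hG.pinv_mul, Matrix.one_mul, h2]

theorem exists_eq_mul_of_matRange_subset {H : Matrix (Fin m) (Fin p) ℍ[ℝ]}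
    {Y : Matrix (Fin m) (Fin q) ℍ[ℝ]} (h : matRange H ⊆ matRange Y) :
    ∃ T : Matrix (Fin q) (Fin p) ℍ[ℝ], H = Y * T := by
  have h1 : ∀ j, ∃ k : Fin q → ℍ[ℝ], Y *ᵥ k = fun i => H i j := by
    intro j
    obtain ⟨k, hk⟩ := h ⟨Pi.single j 1, rfl⟩
    refine ⟨k, hk.trans ?_⟩
    ext1 i
    simp [Matrix.mulVec, dotProduct, Pi.single_apply]
  choose k hk using h1
  refine ⟨Matrix.of fun i j => k j i, ?_⟩
  ext1 i j
  exact (congrFun (hk j) i).symm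

/-- Each range inclusion gives one factor; cancelling `H`, the only matrix known to have full rank,
gives `R' * R = 1`, and a one-sided inverse of a square matrix is two-sided. -/
theorem IsRangefinder.exists_eq_mul {H Y : Matrix (Fin m) (Fin s) ℍ[ℝ]} (h : IsRangefinder H Y) :
    ∃ R R' : Matrix (Fin s) (Fin s) ℍ[ℝ], R * R' = 1 ∧ R' * R = 1 ∧ H = Y * R ∧ Y = H * R' := by
  obtain ⟨R, hR⟩ := exists_eq_mul_of_matRange_subset h.1.subset
  obtain ⟨R', hR'⟩ := exists_eq_mul_of_matRange_subset h.1.superset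
  have h1 : R' * R = 1 := by
    refine sub_eq_zero.1 (h.2.eq_zero_of_mul ?_)
    rw [Matrix.mul_sub, ← Matrix.mul_assoc, ← hR', ← hR, Matrix.mul_one, sub_self]
  exact ⟨R, R', mul_eq_one_symm h1, h1, hR, hR'⟩

end LinearAlgebra

/-! ### Orthonormalisation of quaternion columns. -/

section GramSchmidt

variable {m n p q l s : ℕ}

/-- Append a column to a matrix. -/
def snocCol (A : Matrix (Fin m) (Fin s) ℍ[ℝ]) (b : Matrix (Fin m) (Fin 1) ℍ[ℝ]) :
    Matrix (Fin m) (Fin (s + 1)) ℍ[ℝ] :=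
  Matrix.of fun i => Fin.snoc (α := fun _ => ℍ[ℝ]) (A i) (b i 0)

@[simp] theorem snocCol_castSucc (A : Matrix (Fin m) (Fin s) ℍ[ℝ])
    (b : Matrix (Fin m) (Fin 1) ℍ[ℝ]) (i : Fin m) (j : Fin s) :
    snocCol A b i j.castSucc = A i j := by simp [snocCol]

@[simp] theorem snocCol_last (A : Matrix (Fin m) (Fin s) ℍ[ℝ])
    (b : Matrix (Fin m) (Fin 1) ℍ[ℝ]) (i : Fin m) :
    snocCol A b i (Fin.last s) = b i 0 := by simp [snocCol]

theorem mul_snocCol (C : Matrix (Fin p) (Fin m) ℍ[ℝ]) (A : Matrix (Fin m) (Fin s) ℍ[ℝ])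
    (b : Matrix (Fin m) (Fin 1) ℍ[ℝ]) : C * snocCol A b = snocCol (C * A) (C * b) := by
  ext1 i j
  induction j using Fin.lastCases with
  | last => simp [Matrix.mul_apply]
  | cast j => simp [Matrix.mul_apply]

theorem snocCol_orthonormal {A : Matrix (Fin m) (Fin s) ℍ[ℝ]} {b : Matrix (Fin m) (Fin 1) ℍ[ℝ]}
    (hA : Aᴴ * A = 1) (hAb : Aᴴ * b = 0) (hb : bᴴ * b = 1) :
    (snocCol A b)ᴴ * snocCol A b = 1 := by
  have hbA : bᴴ * A = 0 := by
    simpa [Matrix.conjTranspose_mul] using congrArg Matrix.conjTranspose hAb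
  ext1 i j
  induction i using Fin.lastCases with
  | last =>
    induction j using Fin.lastCases with
    | last => simpa [Matrix.mul_apply] using congrFun (congrFun hb 0) 0
    | cast j =>
      have := congrFun (congrFun hbA 0) j
      rw [Matrix.one_apply_ne (Fin.castSucc_lt_last j).ne']
      simpa [Matrix.mul_apply] using this
  | cast i =>
    induction j using Fin.lastCases with
    | last =>
      have := congrFun (congrFun hAb i) 0
      rw [Matrix.one_apply_ne (Fin.castSucc_lt_last i).ne]
      simpa [Matrix.mul_apply] using this
    | cast j =>
      have := congrFun (congrFun hA i) j
      simpa [Matrix.mul_apply, Matrix.one_apply] using this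

theorem conjTranspose_mul_self_col (v : Matrix (Fin m) (Fin 1) ℍ[ℝ]) :
    vᴴ * v = (‖v‖ ^ 2) • (1 : Matrix (Fin 1) (Fin 1) ℍ[ℝ]) := by
  ext1 i j
  rw [Subsingleton.elim i 0, Subsingleton.elim j 0, frobenius_norm_sq, Matrix.mul_apply]
  simp only [Matrix.conjTranspose_apply, Quaternion.star_mul_self, Finset.univ_unique,
    Fin.default_eq_zero, Finset.sum_singleton, Matrix.smul_apply, Matrix.one_apply_eq,
    Quaternion.normSq_eq_norm_mul_self, ← sq]
  exact (map_sum (algebraMap ℝ ℍ[ℝ]) (fun x => ‖v x 0‖ ^ 2) Finset.univ).symm.trans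
    (Algebra.algebraMap_eq_smul_one _)

theorem exists_orthonormal_mul : ∀ {s : ℕ} {Y : Matrix (Fin m) (Fin s) ℍ[ℝ]},
    FullColumnRank Y → ∃ T : Matrix (Fin s) (Fin s) ℍ[ℝ], (Y * T)ᴴ * (Y * T) = 1 := by
  intro s
  induction s with
  | zero => exact fun _ => ⟨1, Subsingleton.elim _ _⟩
  | succ s ih =>
    intro Y hY
    let E₁ : Matrix (Fin (s + 1)) (Fin s) ℍ[ℝ] :=
      Matrix.of fun i j => if i = j.castSucc then 1 else 0
    let E₂ : Matrix (Fin (s + 1)) (Fin 1) ℍ[ℝ] :=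
      Matrix.of fun i _ => if i = Fin.last s then 1 else 0
    have h11 : E₁ᴴ * E₁ = 1 := by
      ext1 i j
      simp [E₁, Matrix.mul_apply, Matrix.one_apply, apply_ite, eq_comm]
    have h21 : E₂ᴴ * E₁ = 0 := by
      ext1 i j
      simp [E₂, E₁, Matrix.mul_apply, apply_ite]
    have h22 : E₂ᴴ * E₂ = 1 := by
      ext1 i j
      simp [E₂, Matrix.mul_apply, Matrix.one_apply, Subsingleton.elim i j]
    have hY₁ : FullColumnRank (Y * E₁) := by
      refine fullColumnRank_of_leftInverse (W := E₁ᴴ * pinv Y) ?_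
      rw [Matrix.mul_assoc, ← Matrix.mul_assoc (pinv Y), hY.pinv_mul, Matrix.one_mul, h11]
    obtain ⟨T', hT'⟩ := ih hY₁
    set k := pinv (Y * E₁) * (Y * E₂) with hk
    set v := Y * (E₂ - E₁ * k) with hv
    -- The vector `E₂ - E₁ * k` has last coordinate `1`, so the injective `Y` cannot kill it.
    have hv0 : v ≠ 0 := by
      intro h0
      have h1 := hY.eq_zero_of_mul h0
      have h2 : E₂ᴴ * (E₂ - E₁ * k) = 1 := by
        rw [Matrix.mul_sub, ← Matrix.mul_assoc, h21, h22, Matrix.zero_mul, sub_zero]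
      rw [h1, Matrix.mul_zero] at h2
      exact zero_ne_one h2
    have horth : (Y * E₁)ᴴ * v = 0 := by
      have : v = Y * E₂ - Y * E₁ * k := by rw [hv, Matrix.mul_sub, Matrix.mul_assoc]
      rw [this, hk, Matrix.mul_sub, ← Matrix.mul_assoc (Y * E₁), ← Matrix.mul_assoc _ (_ * pinv _),
        conjTranspose_mul_mul_pinv, sub_self]
    refine ⟨snocCol (E₁ * T') (‖v‖⁻¹ • (E₂ - E₁ * k)), ?_⟩
    rw [mul_snocCol, Matrix.mul_smul, ← hv, ← Matrix.mul_assoc]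
    refine snocCol_orthonormal hT' ?_ ?_
    · rw [Matrix.mul_smul, Matrix.conjTranspose_mul, Matrix.mul_assoc, horth, Matrix.mul_zero,
        smul_zero]
    · rw [conjTranspose_mul_self_col, norm_smul, norm_inv, norm_norm,
        inv_mul_cancel₀ (norm_ne_zero_iff.2 hv0), one_pow, one_smul]

/-- A quaternion matrix of full column rank is an orthonormal matrix times an invertible one. -/
theorem FullColumnRank.exists_qr {Y : Matrix (Fin m) (Fin s) ℍ[ℝ]} (hY : FullColumnRank Y) :
    ∃ (Q : Matrix (Fin m) (Fin s) ℍ[ℝ]) (R R' : Matrix (Fin s) (Fin s) ℍ[ℝ]),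
      Qᴴ * Q = 1 ∧ R * R' = 1 ∧ R' * R = 1 ∧ Y = Q * R := by
  obtain ⟨T, hT⟩ := exists_orthonormal_mul hY
  have h1 : (Y * T)ᴴ * Y * T = 1 := by rw [Matrix.mul_assoc, hT]
  have h2 := mul_eq_one_symm h1
  exact ⟨Y * T, (Y * T)ᴴ * Y, T, hT, h1, h2, by rw [Matrix.mul_assoc, h2, Matrix.mul_one]⟩

end GramSchmidt

/-! ### Column residuals and the norm of the pseudoinverse. -/

section ColumnResidual

variable {m n p q l s : ℕ}

/-- The `j`-th standard basis column. -/
noncomputable def basisCol (j : Fin s) : Matrix (Fin s) (Fin 1) ℍ[ℝ] :=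
  Matrix.of fun i _ => if i = j then 1 else 0

theorem basisCol_orthonormal (j : Fin s) : (basisCol j)ᴴ * basisCol j = 1 := by
  ext1 a b
  simp [basisCol, Matrix.mul_apply, Matrix.one_apply, Subsingleton.elim a b]

/-- The projection killing the `j`-th column. -/
noncomputable def dropCol (j : Fin s) : Matrix (Fin s) (Fin s) ℍ[ℝ] := 1 - basisCol j * (basisCol j)ᴴ

theorem dropCol_mul_basisCol (j : Fin s) : dropCol j * basisCol j = 0 := by
  rw [dropCol, Matrix.sub_mul, Matrix.one_mul, Matrix.mul_assoc, basisCol_orthonormal,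
    Matrix.mul_one, sub_self]

/-- The orthogonal projection onto the complement of the range of `C`. -/
noncomputable def complProj (C : Matrix (Fin m) (Fin n) ℍ[ℝ]) : Matrix (Fin m) (Fin m) ℍ[ℝ] :=
  1 - C * pinv C

theorem complProj_conjTranspose (C : Matrix (Fin m) (Fin n) ℍ[ℝ]) :
    (complProj C)ᴴ = complProj C := by
  rw [complProj, Matrix.conjTranspose_sub, (isMoorePenrose_pinv C).left_hermitian,
    Matrix.conjTranspose_one]

theorem complProj_mul_self (C : Matrix (Fin m) (Fin n) ℍ[ℝ]) : complProj C * C = 0 := by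
  rw [complProj, Matrix.sub_mul, (isMoorePenrose_pinv C).mul_mul_self, Matrix.one_mul, sub_self]

theorem complProj_idem (C : Matrix (Fin m) (Fin n) ℍ[ℝ]) :
    complProj C * complProj C = complProj C := by
  have h : complProj C * (1 - C * pinv C) = complProj C := by
    rw [Matrix.mul_sub, ← Matrix.mul_assoc, complProj_mul_self]
    simp
  exact h

/-- The component of the `j`-th column of `G` orthogonal to the other columns. -/
noncomputable def colResidual (G : Matrix (Fin l) (Fin s) ℍ[ℝ]) (j : Fin s) :
    Matrix (Fin l) (Fin 1) ℍ[ℝ] :=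
  complProj (G * dropCol j) * (G * basisCol j)

/-- The sum of the inverse squared norms of the column residuals: the squared norm of the
pseudoinverse when the columns are independent, infinite otherwise. -/
noncomputable def invResidual (G : Matrix (Fin l) (Fin s) ℍ[ℝ]) : ℝ≥0∞ :=
  ∑ j, (ENNReal.ofReal (‖colResidual G j‖ ^ 2))⁻¹

/-- The residuals, each divided by its squared norm, form a dual system to the columns: residual `j`
is orthogonal to every other column and pairs with column `j` to its own squared norm. -/
theorem exists_leftInverse_of_colResidual_ne_zero {G : Matrix (Fin l) (Fin s) ℍ[ℝ]}
    (h : ∀ j, colResidual G j ≠ 0) :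
    ∃ W : Matrix (Fin s) (Fin l) ℍ[ℝ], W * G = 1 ∧ ‖W‖ ^ 2 = ∑ j, (‖colResidual G j‖ ^ 2)⁻¹ := by
  have hw : ∀ j, ((‖colResidual G j‖ ^ 2)⁻¹ • (colResidual G j)ᴴ) * G = (basisCol j)ᴴ := by
    intro j
    have h1 : (colResidual G j)ᴴ * (G * dropCol j) = 0 := by
      rw [colResidual, Matrix.conjTranspose_mul, complProj_conjTranspose, Matrix.mul_assoc,
        complProj_mul_self, Matrix.mul_zero]
    have h2 : (colResidual G j)ᴴ * (G * basisCol j) = (colResidual G j)ᴴ * colResidual G j := by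
      conv_rhs => rw [colResidual, Matrix.conjTranspose_mul, complProj_conjTranspose,
        Matrix.mul_assoc, ← Matrix.mul_assoc (complProj _), complProj_idem]
      rw [colResidual, Matrix.conjTranspose_mul, complProj_conjTranspose, Matrix.mul_assoc]
    have h3 : G = G * dropCol j + G * basisCol j * (basisCol j)ᴴ := by
      rw [dropCol, Matrix.mul_sub, Matrix.mul_one, Matrix.mul_assoc, sub_add_cancel]
    have h4 : (colResidual G j)ᴴ * G = (‖colResidual G j‖ ^ 2) • (basisCol j)ᴴ := by
      have h6 := congrArg ((colResidual G j)ᴴ * ·) h3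
      refine h6.trans ?_
      rw [Matrix.mul_add, h1, zero_add, ← Matrix.mul_assoc, h2, conjTranspose_mul_self_col,
        Matrix.smul_mul, Matrix.one_mul]
    rw [Matrix.smul_mul, h4, smul_smul, inv_mul_cancel₀, one_smul]
    exact pow_ne_zero 2 (norm_ne_zero_iff.2 (h j))
  refine ⟨Matrix.of fun j => ((‖colResidual G j‖ ^ 2)⁻¹ • (colResidual G j)ᴴ) 0, ?_, ?_⟩
  · ext1 j i
    have := congrFun (congrFun (hw j) 0) i
    rw [Matrix.mul_apply] at this ⊢
    refine Eq.trans this ?_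
    simp [basisCol, Matrix.one_apply, apply_ite, eq_comm]
  · rw [frobenius_norm_sq]
    refine Finset.sum_congr rfl fun j _ => ?_
    have h5 : ∑ i, ‖((‖colResidual G j‖ ^ 2)⁻¹ • (colResidual G j)ᴴ) 0 i‖ ^ 2 =
        ‖(‖colResidual G j‖ ^ 2)⁻¹ • (colResidual G j)ᴴ‖ ^ 2 := by
      rw [frobenius_norm_sq ((‖colResidual G j‖ ^ 2)⁻¹ • (colResidual G j)ᴴ)]
      simp
    refine Eq.trans h5 ?_
    rw [norm_smul, Matrix.frobenius_norm_conjTranspose, norm_inv, norm_pow, norm_norm]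
    have := norm_ne_zero_iff.2 (h j)
    field_simp

theorem fullColumnRank_of_invResidual_ne_top {G : Matrix (Fin l) (Fin s) ℍ[ℝ]}
    (h : invResidual G ≠ ∞) : FullColumnRank G ∧ ENNReal.ofReal (‖pinv G‖ ^ 2) ≤ invResidual G := by
  have h1 : ∀ j, 0 < ‖colResidual G j‖ ^ 2 := by
    intro j
    have h2 := ENNReal.sum_ne_top.1 h j (Finset.mem_univ j)
    rwa [ENNReal.inv_ne_top, ne_eq, ENNReal.ofReal_eq_zero, not_le] at h2
  obtain ⟨W, hW, hn⟩ := exists_leftInverse_of_colResidual_ne_zero (G := G) fun j h0 => by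
    simpa [h0] using h1 j
  refine ⟨fullColumnRank_of_leftInverse hW, ?_⟩
  have h3 : invResidual G = ENNReal.ofReal (‖W‖ ^ 2) := by
    rw [hn, ENNReal.ofReal_sum_of_nonneg fun j _ => by positivity]
    exact Finset.sum_congr rfl fun j _ => (ENNReal.ofReal_inv_of_pos (h1 j)).symm
  rw [h3]
  have := norm_pinv_le_of_leftInverse hW
  gcongr

/-- If some residual vanishes the right side is infinite, so no rank hypothesis is required. -/
theorem ofReal_norm_pinv_sq_le (G : Matrix (Fin l) (Fin s) ℍ[ℝ]) :
    ENNReal.ofReal (‖pinv G‖ ^ 2) ≤ invResidual G := by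
  by_cases h : invResidual G = ∞
  · simp [h]
  · exact (fullColumnRank_of_invResidual_ne_top h).2

theorem finrank_quaternionMatrix : Module.finrank ℝ (Matrix (Fin m) (Fin n) ℍ[ℝ]) = 4 * m * n := by
  rw [Module.finrank_matrix, Quaternion.finrank_eq_four]
  simp
  ring

/-- Real dimension of the orthogonal complement of `s - 1` quaternion columns. -/
theorem finrank_range_complProj (G : Matrix (Fin l) (Fin s) ℍ[ℝ]) (j : Fin s) :
    4 * l + 4 ≤ Module.finrank ℝ (LinearMap.range (mulLeftL 1 (complProj (G * dropCol j)))) +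
      4 * s := by
  have h1 := LinearMap.finrank_range_add_finrank_ker (mulLeftL 1 (complProj (G * dropCol j)))
  have h2 := LinearMap.finrank_range_add_finrank_ker (mulLeftL 1 (G * dropCol j))
  rw [finrank_quaternionMatrix] at h1 h2
  have h3 : LinearMap.ker (mulLeftL 1 (complProj (G * dropCol j))) ≤
      LinearMap.range (mulLeftL 1 (G * dropCol j)) := by
    intro x hx
    refine ⟨pinv (G * dropCol j) * x, ?_⟩
    have : complProj (G * dropCol j) * x = 0 := hx
    rw [complProj, Matrix.sub_mul, Matrix.one_mul, sub_eq_zero, Matrix.mul_assoc] at this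
    exact this.symm
  have h4 := Submodule.finrank_mono h3
  -- Since column `j` is dropped, the right multiples of `basisCol j` lie in the kernel. Their four
  -- real dimensions are the `+ 4` of the statement.
  have h5 : LinearMap.range (mulLeftL 1 (basisCol j)) ≤
      LinearMap.ker (mulLeftL 1 (G * dropCol j)) := by
    rintro _ ⟨x, rfl⟩
    change G * dropCol j * (basisCol j * x) = 0
    rw [Matrix.mul_assoc, ← Matrix.mul_assoc (dropCol j), dropCol_mul_basisCol, Matrix.zero_mul,
      Matrix.mul_zero]
  have h6 := Submodule.finrank_mono h5
  rw [LinearMap.finrank_range_of_inj, finrank_quaternionMatrix] at h6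
  · omega
  · intro x y hxy
    have := congrArg ((basisCol j)ᴴ * ·) hxy
    simpa [← Matrix.mul_assoc, basisCol_orthonormal] using this

/-- The residual norm is the distance from column `j` to the span of the others, an infimum over
coefficients attained at the pseudoinverse solution. The supremum form makes its inverse square
lower semicontinuous in `G`, hence measurable, although `pinv` appears in `colResidual`. -/
theorem inv_colResidual_eq_iSup (G : Matrix (Fin l) (Fin s) ℍ[ℝ]) (j : Fin s) :
    (ENNReal.ofReal (‖colResidual G j‖ ^ 2))⁻¹ = ⨆ k : Matrix (Fin s) (Fin 1) ℍ[ℝ],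
      (ENNReal.ofReal (‖mulRightL l (basisCol j - dropCol j * k) G‖ ^ 2))⁻¹ := by
  have h1 : ∀ k : Matrix (Fin s) (Fin 1) ℍ[ℝ], mulRightL l (basisCol j - dropCol j * k) G =
      G * basisCol j - G * dropCol j * k := by
    intro k
    rw [mulRightL_apply, Matrix.mul_sub, Matrix.mul_assoc]
  refine le_antisymm ?_ (iSup_le fun k => ?_)
  · refine le_of_eq_of_le ?_ (le_iSup _ (pinv (G * dropCol j) * (G * basisCol j)))
    rw [h1, colResidual, complProj, Matrix.sub_mul, Matrix.one_mul, Matrix.mul_assoc _ (pinv _)]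
  · rw [h1]
    have h2 : colResidual G j =
        complProj (G * dropCol j) * (G * basisCol j - G * dropCol j * k) := by
      rw [Matrix.mul_sub, ← Matrix.mul_assoc _ _ k, complProj_mul_self, Matrix.zero_mul, sub_zero,
        colResidual]
    have h3 := norm_proj_mul_le (complProj_conjTranspose (G * dropCol j))
      (complProj_idem (G * dropCol j)) (G * basisCol j - G * dropCol j * k)
    rw [← h2] at h3
    gcongr

theorem measurable_inv_colResidual (j : Fin s) :
    Measurable fun G : Matrix (Fin l) (Fin s) ℍ[ℝ] =>
      (ENNReal.ofReal (‖colResidual G j‖ ^ 2))⁻¹ := by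
  simp_rw [inv_colResidual_eq_iSup]
  refine LowerSemicontinuous.measurable (lowerSemicontinuous_iSup fun k => ?_)
  have := (mulRightL l (basisCol j - dropCol j * k)).continuous_of_finiteDimensional
  exact Continuous.lowerSemicontinuous
    (continuous_inv.comp (ENNReal.continuous_ofReal.comp (this.norm.pow 2)))

end ColumnResidual

/-! ### Expected error for a fixed orthonormal basis. -/

section Expectation

variable {m n p q l s : ℕ}

/-- Splitting a Gaussian matrix on the right along `E` and `1 - E`. -/
theorem lintegral_matrix_le_split {E : Matrix (Fin m) (Fin m) ℍ[ℝ]} (hE : Eᴴ = E)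
    (hE2 : E * E = E) (f : Matrix (Fin l) (Fin m) ℍ[ℝ] → ℝ≥0∞) :
    ∫⁻ Ψ, f Ψ ∂stdGaussian (Matrix (Fin l) (Fin m) ℍ[ℝ]) ≤
      ∫⁻ X, ∫⁻ Z, f (X * E + Z * (1 - E)) ∂stdGaussian (Matrix (Fin l) (Fin m) ℍ[ℝ])
        ∂stdGaussian (Matrix (Fin l) (Fin m) ℍ[ℝ]) := by
  refine (lintegral_stdGaussian_le_split (mulRightL l E) (fun x t => ?_) (fun x => ?_) f).trans_eq ?_
  · rw [mulRightL_apply, inner_mul_right_matrix, hE, mulRightL_apply]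
  · simp only [mulRightL_apply, Matrix.mul_assoc, hE2]
  · simp only [mulRightL_apply, Matrix.mul_sub, Matrix.mul_one]

theorem stdGaussian_map_mul_right {Q : Matrix (Fin m) (Fin s) ℍ[ℝ]} (hQ : Qᴴ * Q = 1) (l : ℕ) :
    (stdGaussian (Matrix (Fin l) (Fin m) ℍ[ℝ])).map (mulRightL l Q) =
      stdGaussian (Matrix (Fin l) (Fin s) ℍ[ℝ]) :=
  stdGaussian_map_coisometry _ (fun t => t * Qᴴ) (fun x t => inner_mul_right_matrix x Q t)
    (fun t => norm_mul_coisometry hQ t)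

/-- Splitting `Ψ` along the unit column `q = Q * basisCol j` makes column `j` equal to `Z * q` while
the other columns depend on `X` alone. For fixed `X` the residual is thus a fixed projection of a
Gaussian vector. -/
theorem lintegral_inv_colResidual_le {Q : Matrix (Fin m) (Fin s) ℍ[ℝ]} (hQ : Qᴴ * Q = 1)
    (hsl : s ≤ l) (j : Fin s) :
    ∫⁻ Ψ, (ENNReal.ofReal (‖colResidual (Ψ * Q) j‖ ^ 2))⁻¹
        ∂stdGaussian (Matrix (Fin l) (Fin m) ℍ[ℝ]) ≤
      ENNReal.ofReal (1 / (4 * ((l : ℝ) - s) + 2)) := by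
  set q := Q * basisCol j with hq
  have hqq : qᴴ * q = 1 := by
    rw [hq, Matrix.conjTranspose_mul, Matrix.mul_assoc, ← Matrix.mul_assoc Qᴴ, hQ, Matrix.one_mul,
      basisCol_orthonormal]
  have hqQ : qᴴ * Q = (basisCol j)ᴴ := by
    rw [hq, Matrix.conjTranspose_mul, Matrix.mul_assoc, hQ, Matrix.mul_one]
  have hE : (1 - q * qᴴ)ᴴ = 1 - q * qᴴ := by simp [Matrix.conjTranspose_mul]
  have hE2 : (1 - q * qᴴ) * (1 - q * qᴴ) = 1 - q * qᴴ := by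
    have : q * qᴴ * (q * qᴴ) = q * qᴴ := by
      rw [Matrix.mul_assoc, ← Matrix.mul_assoc qᴴ, hqq, Matrix.one_mul]
    rw [Matrix.mul_sub, Matrix.sub_mul, Matrix.sub_mul, this]
    simp
  have hQb : (1 - q * qᴴ) * (Q * basisCol j) = 0 := by
    rw [← hq, Matrix.sub_mul, Matrix.mul_assoc, hqq]
    simp
  have hbd : (basisCol j)ᴴ * dropCol j = 0 := by
    have h := congrArg Matrix.conjTranspose (dropCol_mul_basisCol j)
    simpa [dropCol, Matrix.conjTranspose_mul] using h
  refine (lintegral_matrix_le_split hE hE2 _).trans ?_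
  have hres : ∀ X Z : Matrix (Fin l) (Fin m) ℍ[ℝ],
      colResidual ((X * (1 - q * qᴴ) + Z * (1 - (1 - q * qᴴ))) * Q) j =
        mulLeftL 1 (complProj (X * Q * dropCol j)) (mulRightL l q Z) := by
    intro X Z
    have h1 : (X * (1 - q * qᴴ) + Z * (1 - (1 - q * qᴴ))) * Q * basisCol j = Z * q := by
      rw [Matrix.mul_assoc, Matrix.add_mul, Matrix.mul_assoc, hQb, Matrix.mul_zero, zero_add,
        sub_sub_cancel, ← hq, Matrix.mul_assoc, Matrix.mul_assoc, hqq, Matrix.mul_one]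
    have h2 : (X * (1 - q * qᴴ) + Z * (1 - (1 - q * qᴴ))) * Q * dropCol j = X * Q * dropCol j := by
      have h3 : q * qᴴ * (Q * dropCol j) = 0 := by
        rw [Matrix.mul_assoc, ← Matrix.mul_assoc qᴴ, hqQ, hbd, Matrix.mul_zero]
      rw [Matrix.mul_assoc, Matrix.add_mul, Matrix.mul_assoc, Matrix.mul_assoc Z, sub_sub_cancel,
        h3, Matrix.mul_zero, add_zero, Matrix.sub_mul, h3, sub_zero, Matrix.one_mul,
        Matrix.mul_assoc]
    rw [colResidual, h1, h2]
    rfl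
  simp_rw [hres]
  refine (lintegral_mono fun X => ?_).trans_eq (lintegral_const _) |>.trans (by simp; rfl)
  have hm : Measurable (mulRightL l q) := (mulRightL l q).continuous_of_finiteDimensional.measurable
  have hm2 : Measurable (mulLeftL 1 (complProj (X * Q * dropCol j))) :=
    (mulLeftL 1 (complProj (X * Q * dropCol j))).continuous_of_finiteDimensional.measurable
  have h := lintegral_inv_norm_sq_proj_le (mulLeftL 1 (complProj (X * Q * dropCol j)))
    (fun x t => by
      rw [mulLeftL_apply, inner_mul_left_matrix, complProj_conjTranspose, mulLeftL_apply])
    -- With `k = 2 (l - s)` the required dimension `2 (k + 2)` is `4 (l - s) + 4`, and the bound `1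
    -- / (2 (k + 1))` is `1 / (4 (l - s) + 2)`.
    (fun x => by simp only [mulLeftL_apply, ← Matrix.mul_assoc, complProj_idem]) (2 * (l - s)) (by
      have := finrank_range_complProj (X * Q) j
      omega)
  rw [← stdGaussian_map_mul_right hqq l, lintegral_map (by fun_prop) hm] at h
  refine h.trans_eq ?_
  congr 2
  push_cast [Nat.cast_sub hsl]
  ring

theorem lintegral_invResidual_le {Q : Matrix (Fin m) (Fin s) ℍ[ℝ]} (hQ : Qᴴ * Q = 1)
    (hsl : s ≤ l) :
    ∫⁻ Ψ, invResidual (Ψ * Q) ∂stdGaussian (Matrix (Fin l) (Fin m) ℍ[ℝ]) ≤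
      ENNReal.ofReal (s / (4 * ((l : ℝ) - s) + 2)) := by
  have hm : Measurable (mulRightL l Q) := (mulRightL l Q).continuous_of_finiteDimensional.measurable
  have hc : ∀ j ∈ Finset.univ, Measurable fun Ψ : Matrix (Fin l) (Fin m) ℍ[ℝ] =>
      (ENNReal.ofReal (‖colResidual (Ψ * Q) j‖ ^ 2))⁻¹ :=
    fun j _ => (measurable_inv_colResidual j).comp hm
  unfold invResidual
  rw [lintegral_finsetSum _ hc]
  refine (Finset.sum_le_sum fun j _ => lintegral_inv_colResidual_le hQ hsl j).trans_eq ?_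
  rw [Finset.sum_const, Finset.card_univ, Fintype.card_fin, nsmul_eq_mul, ← ENNReal.ofReal_natCast,
    ← ENNReal.ofReal_mul (by positivity), mul_one_div]

/-- A finite expectation forces `invResidual` to be finite almost surely, and finiteness means that
no column residual vanishes. -/
theorem ae_fullColumnRank_mul {Q : Matrix (Fin m) (Fin s) ℍ[ℝ]} (hQ : Qᴴ * Q = 1)
    (hsl : s ≤ l) :
    ∀ᵐ Ψ ∂stdGaussian (Matrix (Fin l) (Fin m) ℍ[ℝ]), FullColumnRank (Ψ * Q) := by
  have hm : Measurable (mulRightL l Q) := (mulRightL l Q).continuous_of_finiteDimensional.measurable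
  have hmeas : Measurable fun Ψ : Matrix (Fin l) (Fin m) ℍ[ℝ] => invResidual (Ψ * Q) :=
    Finset.measurable_sum _ fun j _ => (measurable_inv_colResidual j).comp hm
  filter_upwards [ae_lt_top hmeas
    ((lintegral_invResidual_le hQ hsl).trans_lt ENNReal.ofReal_lt_top).ne] with Ψ hΨ
  exact (fullColumnRank_of_invResidual_ne_top hΨ.ne).1

/-- The part of `A` in the range of `Q` is reconstructed exactly; the oblique error from `B` lies in
that range, and `B` is orthogonal to it. -/
theorem reconstruction_error_eq {Q : Matrix (Fin m) (Fin s) ℍ[ℝ]} (hQ : Qᴴ * Q = 1)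
    {Ψ : Matrix (Fin l) (Fin m) ℍ[ℝ]} (hΨ : FullColumnRank (Ψ * Q))
    (A : Matrix (Fin m) (Fin n) ℍ[ℝ]) :
    ‖Q * (pinv (Ψ * Q) * (Ψ * A)) - A‖ ^ 2 =
      ‖pinv (Ψ * Q) * Ψ * ((1 - Q * Qᴴ) * A)‖ ^ 2 + ‖(1 - Q * Qᴴ) * A‖ ^ 2 := by
  set B := (1 - Q * Qᴴ) * A with hB
  have hAB : A = Q * (Qᴴ * A) + B := by
    rw [hB, Matrix.sub_mul, Matrix.one_mul, Matrix.mul_assoc, add_sub_cancel]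
  have hQB : Qᴴ * B = 0 := by
    rw [hB, ← Matrix.mul_assoc, Matrix.mul_sub, ← Matrix.mul_assoc, hQ]
    simp
  have h1 : Q * (pinv (Ψ * Q) * (Ψ * A)) - A = Q * (pinv (Ψ * Q) * Ψ * B) - B := by
    have h2 : pinv (Ψ * Q) * (Ψ * (Q * (Qᴴ * A))) = Qᴴ * A := by
      rw [← Matrix.mul_assoc Ψ, ← Matrix.mul_assoc, hΨ.pinv_mul, Matrix.one_mul]
    have h3 : Q * (pinv (Ψ * Q) * (Ψ * A)) - A =
        Q * (pinv (Ψ * Q) * (Ψ * (Q * (Qᴴ * A) + B))) - (Q * (Qᴴ * A) + B) := by rw [← hAB]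
    rw [h3, Matrix.mul_add Ψ, Matrix.mul_add, h2, Matrix.mul_add, Matrix.mul_assoc _ Ψ]
    abel
  rw [h1, norm_sub_sq_real, inner_mul_left_matrix, hQB, inner_zero_right, norm_isometry_mul hQ]
  ring

/-- Expected reconstruction error for a fixed orthonormal basis and a Gaussian sketch. -/
theorem lintegral_reconstruction_error_le {Q : Matrix (Fin m) (Fin s) ℍ[ℝ]} (hQ : Qᴴ * Q = 1)
    (hsl : s ≤ l) (A : Matrix (Fin m) (Fin n) ℍ[ℝ]) :
    ∫⁻ Ψ, ENNReal.ofReal (‖Q * (pinv (Ψ * Q) * (Ψ * A)) - A‖ ^ 2)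
        ∂stdGaussian (Matrix (Fin l) (Fin m) ℍ[ℝ]) ≤
      ENNReal.ofReal ((1 + gaussianFactor s l) * ‖(1 - Q * Qᴴ) * A‖ ^ 2) := by
  set B := (1 - Q * Qᴴ) * A with hB
  have hden : 0 < 4 * ((l : ℝ) - s) + 2 := by
    have : (s : ℝ) ≤ l := by exact_mod_cast hsl
    linarith
  have hQB : Qᴴ * B = 0 := by
    rw [hB, ← Matrix.mul_assoc, Matrix.mul_sub, ← Matrix.mul_assoc, hQ]
    simp
  have hP : (Q * Qᴴ)ᴴ = Q * Qᴴ := by simp [Matrix.conjTranspose_mul]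
  have hP2 : Q * Qᴴ * (Q * Qᴴ) = Q * Qᴴ := by
    rw [Matrix.mul_assoc, ← Matrix.mul_assoc Qᴴ, hQ, Matrix.one_mul]
  have h1 : ∫⁻ Ψ, ENNReal.ofReal (‖pinv (Ψ * Q) * Ψ * B‖ ^ 2)
      ∂stdGaussian (Matrix (Fin l) (Fin m) ℍ[ℝ]) ≤
      ENNReal.ofReal (gaussianFactor s l * ‖B‖ ^ 2) := by
    -- After this splitting `Ψ * Q` involves only `X` and `Ψ * B` only `Z`, so the inner integral is
    -- a second moment with a fixed pseudoinverse.
    refine (lintegral_matrix_le_split hP hP2 _).trans ?_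
    have h2 : ∀ X Z : Matrix (Fin l) (Fin m) ℍ[ℝ],
        pinv ((X * (Q * Qᴴ) + Z * (1 - Q * Qᴴ)) * Q) * (X * (Q * Qᴴ) + Z * (1 - Q * Qᴴ)) * B =
          pinv (X * Q) * Z * B := by
      intro X Z
      have h3 : (X * (Q * Qᴴ) + Z * (1 - Q * Qᴴ)) * Q = X * Q := by
        have : Q * Qᴴ * Q = Q := by rw [Matrix.mul_assoc, hQ, Matrix.mul_one]
        rw [Matrix.add_mul, Matrix.mul_assoc, this, Matrix.mul_assoc, Matrix.sub_mul, this,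
          Matrix.one_mul, sub_self, Matrix.mul_zero, add_zero]
      have h4 : (X * (Q * Qᴴ) + Z * (1 - Q * Qᴴ)) * B = Z * B := by
        have : Q * Qᴴ * B = 0 := by rw [Matrix.mul_assoc, hQB, Matrix.mul_zero]
        rw [Matrix.add_mul, Matrix.mul_assoc, this, Matrix.mul_assoc, Matrix.sub_mul, this,
          Matrix.one_mul, Matrix.mul_zero, zero_add, sub_zero]
      rw [Matrix.mul_assoc, h3, h4, Matrix.mul_assoc]
    simp_rw [h2, lintegral_norm_sq_mul_mul]
    calc _ ≤ ∫⁻ X, ENNReal.ofReal (4 * ‖B‖ ^ 2) * invResidual (X * Q)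
          ∂stdGaussian (Matrix (Fin l) (Fin m) ℍ[ℝ]) := by
          refine lintegral_mono fun X => ?_
          rw [mul_right_comm, ENNReal.ofReal_mul (by positivity)]
          gcongr
          exact ofReal_norm_pinv_sq_le _
      _ = ENNReal.ofReal (4 * ‖B‖ ^ 2) * ∫⁻ X, invResidual (X * Q)
          ∂stdGaussian (Matrix (Fin l) (Fin m) ℍ[ℝ]) :=
          lintegral_const_mul' _ _ ENNReal.ofReal_ne_top
      _ ≤ ENNReal.ofReal (4 * ‖B‖ ^ 2) * ENNReal.ofReal (s / (4 * ((l : ℝ) - s) + 2)) := by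
          gcongr
          exact lintegral_invResidual_le hQ hsl
      _ = _ := by
          rw [← ENNReal.ofReal_mul (by positivity), gaussianFactor]
          congr 1
          ring
  have hf : 0 ≤ gaussianFactor s l := by
    rw [gaussianFactor]
    positivity
  calc _ ≤ ∫⁻ Ψ, (ENNReal.ofReal (‖pinv (Ψ * Q) * Ψ * B‖ ^ 2) + ENNReal.ofReal (‖B‖ ^ 2))
        ∂stdGaussian (Matrix (Fin l) (Fin m) ℍ[ℝ]) := by
        refine lintegral_mono_ae ?_
        filter_upwards [ae_fullColumnRank_mul hQ hsl] with Ψ hΨ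
        rw [reconstruction_error_eq hQ hΨ, ENNReal.ofReal_add (by positivity) (by positivity)]
    _ ≤ ENNReal.ofReal (gaussianFactor s l * ‖B‖ ^ 2) + ENNReal.ofReal (‖B‖ ^ 2) := by
        rw [lintegral_add_right _ measurable_const, lintegral_const, measure_univ, mul_one]
        gcongr
    _ = _ := by
        rw [← ENNReal.ofReal_add (by positivity) (by positivity)]
        congr 1
        ring

end Expectation

/-! ### From independent real coordinates to Gaussian measures on matrices. -/

section Law

variable {m n : ℕ}

/-- The quaternion matrix with given real coordinates. -/
noncomputable def ofRealCoords (m n : ℕ) :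
    (Fin m × Fin n × Fin 4 → ℝ) →ₗ[ℝ] Matrix (Fin m) (Fin n) ℍ[ℝ] where
  toFun x := Matrix.of fun i j => ∑ c, x (i, j, c) • quaternionUnit c
  map_add' x y := by
    ext1 i j
    simp only [Pi.add_apply, add_smul, Finset.sum_add_distrib, Matrix.of_apply, Matrix.add_apply]
  map_smul' r x := by
    ext1 i j
    simp only [Pi.smul_apply, smul_assoc, ← Finset.smul_sum, Matrix.of_apply, Matrix.smul_apply,
      RingHom.id_apply]

theorem ofRealCoords_realCoords (M : Matrix (Fin m) (Fin n) ℍ[ℝ]) :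
    ofRealCoords m n (realCoords M) = M := by
  ext1 i j
  change ∑ c, coord (M i j) c • quaternionUnit c = M i j
  rw [Fin.sum_univ_four]
  apply Quaternion.ext <;>
  simp only [Quaternion.re_add, Quaternion.imI_add, Quaternion.imJ_add, Quaternion.imK_add,
    Quaternion.re_smul, Quaternion.imI_smul, Quaternion.imJ_smul, Quaternion.imK_smul] <;>
  simp [coord, quaternionUnit]

theorem measurable_ofRealCoords : Measurable (ofRealCoords m n) :=
  (ofRealCoords m n).continuous_of_finiteDimensional.measurable

/-- The quaternion units are orthonormal, so `realCoords` is an isometry adjoint to `ofRealCoords`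
once the coordinates carry the Euclidean norm. -/
theorem map_ofRealCoords_pi :
    (Measure.pi fun _ : Fin m × Fin n × Fin 4 => gaussianReal 0 1).map (ofRealCoords m n) =
      stdGaussian (Matrix (Fin m) (Fin n) ℍ[ℝ]) := by
  rw [← stdGaussian_map_coisometry
    (E := EuclideanSpace ℝ (Fin m × Fin n × Fin 4))
    ((ofRealCoords m n).comp (WithLp.linearEquiv 2 ℝ (Fin m × Fin n × Fin 4 → ℝ)).toLinearMap)
    (fun t => WithLp.toLp 2 (realCoords t)) (fun x t => ?_) (fun t => ?_), ← map_pi_eq_stdGaussian,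
    Measure.map_map]
  · rfl
  · exact (LinearMap.continuous_of_finiteDimensional _).measurable
  · fun_prop
  · rw [inner_def, PiLp.inner_apply]
    simp only [Fintype.sum_prod_type]
    refine Finset.sum_congr rfl fun i _ => Finset.sum_congr rfl fun j _ => ?_
    change inner ℝ (∑ c, x (i, j, c) • quaternionUnit c) (t i j) = _
    rw [sum_inner]
    refine Finset.sum_congr rfl fun c _ => ?_
    rw [inner_smul_left, real_inner_comm, inner_quaternionUnit]
    simp [realCoords, mul_comm]
  · rw [← sq_eq_sq₀ (norm_nonneg _) (norm_nonneg _), EuclideanSpace.norm_sq_eq, frobenius_norm_sq]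
    simp only [Fintype.sum_prod_type]
    refine Finset.sum_congr rfl fun i _ => Finset.sum_congr rfl fun j _ => ?_
    rw [norm_sq_eq_sum_coord]
    simp [realCoords]

variable {S : Type*} [MeasurableSpace S] {P : Measure S}

theorem IsStdGaussian.aemeasurable_realCoords {G : S → Matrix (Fin m) (Fin n) ℍ[ℝ]}
    (hG : IsStdGaussian P G) : AEMeasurable (fun ω => realCoords (G ω)) P :=
  aemeasurable_pi_lambda _ fun p => (hG.law p).aemeasurable

theorem IsStdGaussian.aemeasurable {G : S → Matrix (Fin m) (Fin n) ℍ[ℝ]}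
    (hG : IsStdGaussian P G) : AEMeasurable G P := by
  have h := measurable_ofRealCoords.comp_aemeasurable hG.aemeasurable_realCoords
  simpa only [Function.comp_def, ofRealCoords_realCoords] using h

theorem IsStdGaussian.map_eq [IsProbabilityMeasure P] {G : S → Matrix (Fin m) (Fin n) ℍ[ℝ]}
    (hG : IsStdGaussian P G) : P.map G = stdGaussian (Matrix (Fin m) (Fin n) ℍ[ℝ]) := by
  have h1 := (iIndepFun_iff_map_fun_eq_pi_map fun p => (hG.law p).aemeasurable).1 hG.indep
  simp_rw [fun p => (hG.law p).map_eq] at h1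
  rw [← map_ofRealCoords_pi, ← h1,
    AEMeasurable.map_map_of_aemeasurable measurable_ofRealCoords.aemeasurable
      hG.aemeasurable_realCoords]
  congr 1
  ext1 ω
  exact (ofRealCoords_realCoords (G ω)).symm

theorem map_prod_eq [IsProbabilityMeasure P] {p q : ℕ} {Ω : S → Matrix (Fin m) (Fin n) ℍ[ℝ]}
    {Ψ : S → Matrix (Fin p) (Fin q) ℍ[ℝ]} (hΩ : IsStdGaussian P Ω) (hΨ : IsStdGaussian P Ψ)
    (hind : IndepFun (fun ω => realCoords (Ω ω)) (fun ω => realCoords (Ψ ω)) P) :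
    P.map (fun ω => (Ω ω, Ψ ω)) = (stdGaussian (Matrix (Fin m) (Fin n) ℍ[ℝ])).prod
      (stdGaussian (Matrix (Fin p) (Fin q) ℍ[ℝ])) := by
  have h := hind.comp (measurable_ofRealCoords (m := m) (n := n))
    (measurable_ofRealCoords (m := p) (n := q))
  simp only [Function.comp_def, ofRealCoords_realCoords] at h
  rw [← hΩ.map_eq, ← hΨ.map_eq]
  exact (indepFun_iff_map_prod_eq_prod_map_map hΩ.aemeasurable hΨ.aemeasurable).1 h

/-- Conjugate transposition as a real-linear map. -/
noncomputable def conjTransposeL (m n : ℕ) :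
    Matrix (Fin m) (Fin n) ℍ[ℝ] →ₗ[ℝ] Matrix (Fin n) (Fin m) ℍ[ℝ] where
  toFun M := Mᴴ
  map_add' := Matrix.conjTranspose_add
  map_smul' r M := by
    ext1 i j
    exact Quaternion.star_smul r (M j i)

theorem stdGaussian_map_conjTranspose (m n : ℕ) :
    (stdGaussian (Matrix (Fin m) (Fin n) ℍ[ℝ])).map (conjTransposeL m n) =
      stdGaussian (Matrix (Fin n) (Fin m) ℍ[ℝ]) :=
  stdGaussian_map_coisometry _ (fun t => tᴴ)
    (fun x t => by
      rw [← inner_conjTranspose x, Matrix.conjTranspose_conjTranspose]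
      rfl)
    (fun t => Matrix.frobenius_norm_conjTranspose t)

end Law

/-! ### The spectral tail as a projection residual. -/

section SingularValues

variable {m n r : ℕ}

/-- The first `r` standard basis columns. -/
noncomputable def leadingCols (hr : r ≤ n) : Matrix (Fin n) (Fin r) ℍ[ℝ] :=
  Matrix.of fun i j => if i = Fin.castLE hr j then 1 else 0

theorem leadingCols_orthonormal (hr : r ≤ n) : (leadingCols hr)ᴴ * leadingCols hr = 1 := by
  ext1 i j
  simp [leadingCols, Matrix.mul_apply, Matrix.one_apply, apply_ite, eq_comm]

theorem one_sub_leadingCols_mul (hr : r ≤ n) :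
    1 - leadingCols hr * (leadingCols hr)ᴴ =
      Matrix.diagonal fun i : Fin n => if r ≤ (i : ℕ) then (1 : ℍ[ℝ]) else 0 := by
  ext1 i j
  have h : (leadingCols hr * (leadingCols hr)ᴴ) i j =
      if i = j then (if r ≤ (i : ℕ) then (0 : ℍ[ℝ]) else 1) else 0 := by
    simp only [leadingCols, Matrix.mul_apply, Matrix.conjTranspose_apply, Matrix.of_apply,
      apply_ite star, star_one, star_zero, ite_mul, one_mul, zero_mul]
    by_cases hi : r ≤ (i : ℕ)
    · rw [Finset.sum_eq_zero]
      · simp [hi]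
      · intro k _
        rw [if_neg]
        rintro rfl
        simp at hi
        omega
    · rw [Finset.sum_eq_single ⟨i, not_le.1 hi⟩]
      · simp [hi, eq_comm]
      · intro k _ hk
        rw [if_neg]
        rintro rfl
        exact hk rfl
      · simp
  rw [Matrix.sub_apply, h, Matrix.one_apply, Matrix.diagonal_apply]
  split_ifs <;> simp

theorem trailingBlock_norm_sq (σ : Fin n → ℝ) :
    ‖trailingBlock r σ‖ ^ 2 = ∑ i : Fin n, if r ≤ (i : ℕ) then σ i ^ 2 else 0 := by
  rw [trailingBlock, Matrix.submatrix_diagonal _ _ Subtype.val_injective,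
    Matrix.frobenius_norm_diagonal, EuclideanSpace.norm_sq_eq, ← Finset.sum_filter]
  simp only [Function.comp_apply, Real.norm_eq_abs, sq_abs]
  exact (Finset.sum_subtype _ (by simp) fun i => σ i ^ 2).symm

/-- Conjugation by `V` turns the projection into a diagonal one. The outer factors `V` and `Uᴴ`
preserve the norm, which leaves the singular values of index at least `r`. -/
theorem IsQSVD.norm_tail {A U : Matrix (Fin m) (Fin n) ℍ[ℝ]} {σ : Fin n → ℝ}
    {V : Matrix (Fin n) (Fin n) ℍ[ℝ]} (hA : IsQSVD A U σ V) (hr : r ≤ n) :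
    ‖(1 - V * leadingCols hr * (V * leadingCols hr)ᴴ) * Aᴴ‖ ^ 2 = ‖trailingBlock r σ‖ ^ 2 := by
  have h1 : (1 - V * leadingCols hr * (V * leadingCols hr)ᴴ) * Aᴴ =
      V * ((1 - leadingCols hr * (leadingCols hr)ᴴ) *
        ((Matrix.diagonal σ).map (fun t : ℝ => (t : ℍ[ℝ])))ᴴ) * Uᴴ := by
    have h2 : (1 - V * leadingCols hr * (V * leadingCols hr)ᴴ) * V =
        V * (1 - leadingCols hr * (leadingCols hr)ᴴ) := by
      simp only [Matrix.sub_mul, Matrix.one_mul, Matrix.conjTranspose_mul, Matrix.mul_assoc,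
        hA.right_unitary.1, Matrix.mul_one, Matrix.mul_sub]
    rw [hA.eq_mul, Matrix.conjTranspose_mul _ Vᴴ, Matrix.conjTranspose_mul U,
      Matrix.conjTranspose_conjTranspose, ← Matrix.mul_assoc, h2]
    simp only [Matrix.mul_assoc]
  have h3 : ((Matrix.diagonal σ).map (fun t : ℝ => (t : ℍ[ℝ])))ᴴ =
      Matrix.diagonal fun i => (σ i : ℍ[ℝ]) := by
    rw [Matrix.diagonal_map (by simp), Matrix.diagonal_conjTranspose]
    congr 1
    ext1 i
    simp
  rw [h1, norm_mul_coisometry hA.left_orthonormal, norm_isometry_mul hA.right_unitary.1,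
    one_sub_leadingCols_mul, h3, Matrix.diagonal_mul_diagonal, Matrix.frobenius_norm_diagonal,
    PiLp.norm_sq_eq_of_L2, trailingBlock_norm_sq]
  refine Finset.sum_congr rfl fun i _ => ?_
  by_cases hi : r ≤ (i : ℕ) <;> simp [hi]

end SingularValues

/-! ### Combining the two sketches, and measurability of the error. -/

section Assembly

instance secondCountableTopology_matrix {m n : ℕ} :
    SecondCountableTopology (Matrix (Fin m) (Fin n) ℍ[ℝ]) :=
  have : ProperSpace (Matrix (Fin m) (Fin n) ℍ[ℝ]) := FiniteDimensional.proper_real _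
  secondCountable_of_proper

variable {m n r s l : ℕ}

theorem ae_fullColumnRank_sketch {Y : Matrix (Fin m) (Fin s) ℍ[ℝ]} (hY : FullColumnRank Y)
    (hsl : s ≤ l) : ∀ᵐ Ψ ∂stdGaussian (Matrix (Fin l) (Fin m) ℍ[ℝ]), FullColumnRank (Ψ * Y) := by
  obtain ⟨Q, R, R', hQ, -, h2, rfl⟩ := hY.exists_qr
  filter_upwards [ae_fullColumnRank_mul hQ hsl] with Ψ hΨ
  rw [← Matrix.mul_assoc]
  exact hΨ.mul_isUnit h2

/-- The error of the one-pass reconstruction with range `R(Y)`. -/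
noncomputable def sketchError (A : Matrix (Fin m) (Fin n) ℍ[ℝ]) (Ω : Matrix (Fin n) (Fin s) ℍ[ℝ])
    (Ψ : Matrix (Fin l) (Fin m) ℍ[ℝ]) : ℝ :=
  ‖A * Ω * (pinv (Ψ * (A * Ω)) * (Ψ * A)) - A‖ ^ 2

/-- Averaging over `Ψ` costs a constant factor over the error of any approximation of `A` whose
columns lie in the range of the sketch. -/
theorem lintegral_sketchError_le (A : Matrix (Fin m) (Fin n) ℍ[ℝ])
    {Ω : Matrix (Fin n) (Fin s) ℍ[ℝ]} (hY : FullColumnRank (A * Ω)) (hsl : s ≤ l)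
    (Z : Matrix (Fin s) (Fin n) ℍ[ℝ]) :
    ∫⁻ Ψ, ENNReal.ofReal (sketchError A Ω Ψ) ∂stdGaussian (Matrix (Fin l) (Fin m) ℍ[ℝ]) ≤
      ENNReal.ofReal (1 + gaussianFactor s l) * ENNReal.ofReal (‖A * Ω * Z - A‖ ^ 2) := by
  obtain ⟨Q, R, R', hQ, h1, h2, hQR⟩ := hY.exists_qr
  have hf : 0 ≤ gaussianFactor s l := by
    have : (s : ℝ) ≤ l := by exact_mod_cast hsl
    rw [gaussianFactor]
    exact div_nonneg (by positivity) (by linarith)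
  have hE : (1 - Q * Qᴴ)ᴴ = 1 - Q * Qᴴ := by simp [Matrix.conjTranspose_mul]
  have hQ0 : (1 - Q * Qᴴ) * Q = 0 := by
    rw [Matrix.sub_mul, Matrix.mul_assoc, hQ]
    simp
  have hE2 : (1 - Q * Qᴴ) * (1 - Q * Qᴴ) = 1 - Q * Qᴴ := by
    rw [Matrix.mul_sub, ← Matrix.mul_assoc, hQ0]
    simp
  -- Best approximation: `1 - Q Qᴴ` annihilates everything in the range of `A * Ω`, so subtracting
  -- `A * Ω * Z` first changes nothing.
  have h3 : ‖(1 - Q * Qᴴ) * A‖ ≤ ‖A * Ω * Z - A‖ := by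
    have h4 : (1 - Q * Qᴴ) * A = (1 - Q * Qᴴ) * (A - A * Ω * Z) := by
      rw [hQR, Matrix.mul_sub, Matrix.mul_assoc Q, ← Matrix.mul_assoc _ Q, hQ0, Matrix.zero_mul,
        sub_zero]
    rw [h4, norm_sub_rev (A * Ω * Z)]
    exact norm_proj_mul_le hE hE2 _
  calc _ ≤ ∫⁻ Ψ, ENNReal.ofReal (‖Q * (pinv (Ψ * Q) * (Ψ * A)) - A‖ ^ 2)
        ∂stdGaussian (Matrix (Fin l) (Fin m) ℍ[ℝ]) := by
        refine lintegral_mono_ae ?_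
        filter_upwards [ae_fullColumnRank_mul hQ hsl] with Ψ hΨ
        rw [sketchError, hQR, ← Matrix.mul_assoc, mul_pinv_mul_of_isUnit hΨ h1 h2,
          Matrix.mul_assoc]
    _ ≤ _ := lintegral_reconstruction_error_le hQ hsl A
    _ ≤ _ := by
        rw [← ENNReal.ofReal_mul (by linarith)]
        gcongr

theorem gaussianFactor_nonneg (h : r ≤ s) : 0 ≤ gaussianFactor r s := by
  have : (r : ℝ) ≤ s := by exact_mod_cast h
  rw [gaussianFactor]
  exact div_nonneg (by positivity) (by linarith)

theorem one_add_gaussianFactor (h : r ≤ s) :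
    1 + gaussianFactor r s = (2 * (s : ℝ) + 1) / (2 * ((s : ℝ) - (r : ℝ)) + 1) := by
  have h1 : (r : ℝ) ≤ s := by exact_mod_cast h
  have h2 : 2 * ((s : ℝ) - r) + 1 ≠ 0 := by linarith
  have h3 : 4 * ((s : ℝ) - r) + 2 = 2 * (2 * ((s : ℝ) - r) + 1) := by ring
  rw [gaussianFactor, h3]
  field_simp
  ring

/-- The fixed-basis estimate is used for `Ψ` against `A` and, after conjugate transposition, for
`Ωᴴ` against `Aᴴ` with the leading right singular vectors as basis. -/
theorem lintegral_prod_sketchError_le {A U : Matrix (Fin m) (Fin n) ℍ[ℝ]} {σ : Fin n → ℝ}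
    {V : Matrix (Fin n) (Fin n) ℍ[ℝ]} (hA : IsQSVD A U σ V) (hrs : r ≤ s) (hsl : s ≤ l)
    (hr : r ≤ n) (hY : ∀ᵐ Ω ∂stdGaussian (Matrix (Fin n) (Fin s) ℍ[ℝ]), FullColumnRank (A * Ω)) :
    ∫⁻ z, ENNReal.ofReal (sketchError A z.1 z.2)
      ∂(stdGaussian (Matrix (Fin n) (Fin s) ℍ[ℝ])).prod
        (stdGaussian (Matrix (Fin l) (Fin m) ℍ[ℝ])) ≤
      ENNReal.ofReal ((1 + gaussianFactor s l) * (1 + gaussianFactor r s) *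
        ‖trailingBlock r σ‖ ^ 2) := by
  set Q := V * leadingCols hr with hQdef
  have hQ : Qᴴ * Q = 1 := by
    rw [hQdef, Matrix.conjTranspose_mul, Matrix.mul_assoc, ← Matrix.mul_assoc Vᴴ,
      hA.right_unitary.1, Matrix.one_mul, leadingCols_orthonormal]
  let h : Matrix (Fin s) (Fin n) ℍ[ℝ] → ℝ≥0∞ := fun Φ =>
    ENNReal.ofReal (‖Q * (pinv (Φ * Q) * (Φ * Aᴴ)) - Aᴴ‖ ^ 2)
  have hfl := gaussianFactor_nonneg hsl
  calc _ ≤ ∫⁻ Ω, ∫⁻ Ψ, ENNReal.ofReal (sketchError A Ω Ψ)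
        ∂stdGaussian (Matrix (Fin l) (Fin m) ℍ[ℝ]) ∂stdGaussian (Matrix (Fin n) (Fin s) ℍ[ℝ]) :=
        lintegral_prod_le _
    _ ≤ ∫⁻ Ω, ENNReal.ofReal (1 + gaussianFactor s l) * h Ωᴴ
        ∂stdGaussian (Matrix (Fin n) (Fin s) ℍ[ℝ]) := by
        refine lintegral_mono_ae ?_
        filter_upwards [hY] with Ω hΩ
        -- For this `Z`, the conjugate transpose of `A Ω Z - A` is `Q (Ωᴴ Q)† Ωᴴ Aᴴ - Aᴴ`.
        refine (lintegral_sketchError_le A hΩ hsl ((pinv (Ωᴴ * Q))ᴴ * Qᴴ)).trans_eq ?_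
        simp only [h]
        rw [← Matrix.frobenius_norm_conjTranspose (A * Ω * _ - A)]
        simp only [Matrix.conjTranspose_sub, Matrix.conjTranspose_mul,
          Matrix.conjTranspose_conjTranspose, Matrix.mul_assoc]
    _ = ENNReal.ofReal (1 + gaussianFactor s l) * ∫⁻ Ω, h Ωᴴ
        ∂stdGaussian (Matrix (Fin n) (Fin s) ℍ[ℝ]) :=
        lintegral_const_mul' _ _ ENNReal.ofReal_ne_top
    _ ≤ ENNReal.ofReal (1 + gaussianFactor s l) * ∫⁻ Φ, h Φ
        ∂stdGaussian (Matrix (Fin s) (Fin n) ℍ[ℝ]) := by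
        gcongr
        rw [← stdGaussian_map_conjTranspose s n]
        refine (lintegral_map_le _ _).trans_eq (lintegral_congr fun Φ => ?_)
        exact congrArg h (Matrix.conjTranspose_conjTranspose Φ)
    _ ≤ ENNReal.ofReal (1 + gaussianFactor s l) *
        ENNReal.ofReal ((1 + gaussianFactor r s) * ‖trailingBlock r σ‖ ^ 2) := by
        rw [← hA.norm_tail hr]
        gcongr
        exact lintegral_reconstruction_error_le hQ hrs Aᴴ
    _ = _ := by rw [← ENNReal.ofReal_mul (by linarith), mul_assoc]

theorem isOpen_fullColumnRank {T : Type*} [TopologicalSpace T]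
    {G : T → Matrix (Fin m) (Fin n) ℍ[ℝ]} (hG : Continuous G) :
    IsOpen {t | FullColumnRank (G t)} := by
  have h : {t | FullColumnRank (G t)} = {t | IsUnit ((G t)ᴴ * G t)} := by
    ext1 t
    exact ⟨FullColumnRank.isUnit, fullColumnRank_of_isUnit⟩
  rw [h]
  exact isOpen_isUnit_matrix.preimage (hG.matrix_conjTranspose.matrix_mul hG)

/-- On the full-rank locus the pseudoinverse is `(Gᴴ G)⁻¹ Gᴴ`, built from continuous operations. -/
theorem continuousOn_pinv {T : Type*} [TopologicalSpace T]
    {G : T → Matrix (Fin m) (Fin n) ℍ[ℝ]} (hG : Continuous G) :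
    ContinuousOn (fun t => pinv (G t)) {t | FullColumnRank (G t)} := by
  have hc : Continuous fun t => (G t)ᴴ * G t := hG.matrix_conjTranspose.matrix_mul hG
  refine ContinuousOn.congr (f := fun t => Ring.inverse ((G t)ᴴ * G t) * (G t)ᴴ) ?_
    fun t ht => FullColumnRank.pinv_eq ht
  intro t ht
  have h1 : ContinuousAt (fun t => Ring.inverse ((G t)ᴴ * G t)) t :=
    ContinuousAt.comp (f := fun t => (G t)ᴴ * G t) (continuousAt_inverse_matrix ht.isUnit)
      hc.continuousAt
  have h2 : Continuous fun z : Matrix (Fin n) (Fin n) ℍ[ℝ] × Matrix (Fin n) (Fin m) ℍ[ℝ] =>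
      z.1 * z.2 := continuous_fst.matrix_mul continuous_snd
  exact (h2.continuousAt.comp (h1.prodMk hG.matrix_conjTranspose.continuousAt)).continuousWithinAt

/-- The error is continuous on an open set of full measure, so its values where `Ψ Y` loses rank do
not matter. -/
theorem aestronglyMeasurable_sketchError (A : Matrix (Fin m) (Fin n) ℍ[ℝ])
    {μ : Measure (Matrix (Fin n) (Fin s) ℍ[ℝ] × Matrix (Fin l) (Fin m) ℍ[ℝ])}
    (hμ : ∀ᵐ z ∂μ, FullColumnRank (z.2 * (A * z.1))) :
    AEStronglyMeasurable (fun z => sketchError A z.1 z.2) μ := by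
  have hA : Continuous fun _ : Matrix (Fin n) (Fin s) ℍ[ℝ] × Matrix (Fin l) (Fin m) ℍ[ℝ] => A :=
    continuous_const
  have hY : Continuous fun z : Matrix (Fin n) (Fin s) ℍ[ℝ] × Matrix (Fin l) (Fin m) ℍ[ℝ] =>
      A * z.1 := hA.matrix_mul continuous_fst
  have hG : Continuous fun z : Matrix (Fin n) (Fin s) ℍ[ℝ] × Matrix (Fin l) (Fin m) ℍ[ℝ] =>
      z.2 * (A * z.1) := continuous_snd.matrix_mul hY
  have hW : Continuous fun z : Matrix (Fin n) (Fin s) ℍ[ℝ] × Matrix (Fin l) (Fin m) ℍ[ℝ] =>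
      z.2 * A := continuous_snd.matrix_mul hA
  have hmul : ∀ {a b c : ℕ}, Continuous
      fun z : Matrix (Fin a) (Fin b) ℍ[ℝ] × Matrix (Fin b) (Fin c) ℍ[ℝ] => z.1 * z.2 :=
    continuous_fst.matrix_mul continuous_snd
  have hX := hmul.comp_continuousOn ((continuousOn_pinv hG).prodMk hW.continuousOn)
  have hE := hmul.comp_continuousOn (hY.continuousOn.prodMk hX)
  have hF : ContinuousOn (fun z => sketchError A z.1 z.2)
      {z : Matrix (Fin n) (Fin s) ℍ[ℝ] × Matrix (Fin l) (Fin m) ℍ[ℝ] |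
        FullColumnRank (z.2 * (A * z.1))} :=
    ((hE.sub hA.continuousOn).norm).pow 2
  rw [← Measure.restrict_eq_self_of_ae_mem hμ]
  exact hF.aestronglyMeasurable (isOpen_fullColumnRank hG).measurableSet

end Assembly

end QuaternionSketch

/-! ### The expected error of the one-pass approximation. -/

theorem mainTheorem3 {S : Type*} [MeasurableSpace S] (P : Measure S) [IsProbabilityMeasure P]
    (m n r s l : ℕ) (hnm : n ≤ m) (hrs : r ≤ s) (hsl : s ≤ l) (hl : l ≤ min m n)
    (A : Matrix (Fin m) (Fin n) ℍ[ℝ])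
    (U : Matrix (Fin m) (Fin n) ℍ[ℝ]) (σ : Fin n → ℝ) (V : Matrix (Fin n) (Fin n) ℍ[ℝ])
    (hA : QuaternionSketch.IsQSVD A U σ V)
    (Ω : S → Matrix (Fin n) (Fin s) ℍ[ℝ]) (Ψ : S → Matrix (Fin l) (Fin m) ℍ[ℝ])
    (hΩ : QuaternionSketch.IsStdGaussian P Ω) (hΨ : QuaternionSketch.IsStdGaussian P Ψ)
    (hind : IndepFun (fun ω => QuaternionSketch.realCoords (Ω ω))
      (fun ω => QuaternionSketch.realCoords (Ψ ω)) P)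
    (H : S → Matrix (Fin m) (Fin s) ℍ[ℝ])
    (hH : ∀ᵐ ω ∂P, QuaternionSketch.IsRangefinder (H ω) (A * Ω ω)) :
    Integrable (fun ω => ‖H ω * QuaternionSketch.qbFactor (Ψ ω) (H ω) (Ψ ω * A) - A‖ ^ 2) P ∧
    ∫ ω, ‖H ω * QuaternionSketch.qbFactor (Ψ ω) (H ω) (Ψ ω * A) - A‖ ^ 2 ∂P ≤
      (1 + QuaternionSketch.gaussianFactor s l) * (1 + QuaternionSketch.gaussianFactor r s) *
        ‖QuaternionSketch.trailingBlock r σ‖ ^ 2 ∧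
    (1 + QuaternionSketch.gaussianFactor s l) * (1 + QuaternionSketch.gaussianFactor r s) *
        ‖QuaternionSketch.trailingBlock r σ‖ ^ 2 =
      ((2 * (l : ℝ) + 1) / (2 * ((l : ℝ) - (s : ℝ)) + 1)) *
        ((2 * (s : ℝ) + 1) / (2 * ((s : ℝ) - (r : ℝ)) + 1)) *
        ‖QuaternionSketch.trailingBlock r σ‖ ^ 2 := by
  have hr : r ≤ n := (hrs.trans hsl).trans (hl.trans (min_le_right _ _))
  set γ₁ := stdGaussian (Matrix (Fin n) (Fin s) ℍ[ℝ])
  set γ₂ := stdGaussian (Matrix (Fin l) (Fin m) ℍ[ℝ])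
  have hmap : P.map (fun ω => (Ω ω, Ψ ω)) = γ₁.prod γ₂ := QuaternionSketch.map_prod_eq hΩ hΨ hind
  have hpair : AEMeasurable (fun ω => (Ω ω, Ψ ω)) P := hΩ.aemeasurable.prodMk hΨ.aemeasurable
  -- The rank of `A Ω` comes from the rangefinder: `A Ω` is `H` times an invertible matrix. Openness
  -- of the full-rank set lets the property pass to the law of `Ω`.
  have hY : ∀ᵐ Ω' ∂γ₁, QuaternionSketch.FullColumnRank (A * Ω') := by
    have ho := QuaternionSketch.isOpen_fullColumnRank
      (G := fun Ω' : Matrix (Fin n) (Fin s) ℍ[ℝ] => A * Ω') (continuous_const.matrix_mul continuous_id)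
    rw [← show P.map Ω = γ₁ from hΩ.map_eq, ae_map_iff hΩ.aemeasurable ho.measurableSet]
    filter_upwards [hH] with ω hω
    obtain ⟨R, R', h1, -, -, h4⟩ := hω.exists_eq_mul
    rw [h4]
    exact hω.2.mul_isUnit h1
  have hG : Continuous fun z : Matrix (Fin n) (Fin s) ℍ[ℝ] × Matrix (Fin l) (Fin m) ℍ[ℝ] =>
      z.2 * (A * z.1) := continuous_snd.matrix_mul (continuous_const.matrix_mul continuous_fst)
  have hoG := (QuaternionSketch.isOpen_fullColumnRank hG).measurableSet
  have hfull : ∀ᵐ z ∂γ₁.prod γ₂, QuaternionSketch.FullColumnRank (z.2 * (A * z.1)) := by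
    refine (Measure.ae_prod_mem_iff_ae_ae_mem hoG).2 ?_
    filter_upwards [hY] with Ω' hΩ'
    exact QuaternionSketch.ae_fullColumnRank_sketch hΩ' hsl
  have hmeas := QuaternionSketch.aestronglyMeasurable_sketchError A hfull
  have hlint := QuaternionSketch.lintegral_prod_sketchError_le (l := l) hA hrs hsl hr hY
  -- No measurability of `H` is assumed; the error agrees almost surely with a function of `(Ω, Ψ)`
  -- alone.
  have heq : (fun ω => QuaternionSketch.sketchError A (Ω ω) (Ψ ω)) =ᵐ[P] fun ω =>
      ‖H ω * QuaternionSketch.qbFactor (Ψ ω) (H ω) (Ψ ω * A) - A‖ ^ 2 := by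
    have hfull' : ∀ᵐ ω ∂P, QuaternionSketch.FullColumnRank (Ψ ω * (A * Ω ω)) := by
      rw [← hmap] at hfull
      exact ae_of_ae_map hpair hfull
    filter_upwards [hH, hfull'] with ω hω hω'
    obtain ⟨R, R', h1, h2, h3, -⟩ := hω.exists_eq_mul
    rw [QuaternionSketch.sketchError, QuaternionSketch.qbFactor, h3, ← Matrix.mul_assoc (A * Ω ω),
      ← Matrix.mul_assoc (A * Ω ω * R), QuaternionSketch.mul_pinv_mul_of_isUnit hω' h1 h2]
  have hmeasP : AEStronglyMeasurable
      (fun ω => QuaternionSketch.sketchError A (Ω ω) (Ψ ω)) P := by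
    rw [← hmap] at hmeas
    exact hmeas.comp_aemeasurable hpair
  have hlintP : ∫⁻ ω, ENNReal.ofReal (QuaternionSketch.sketchError A (Ω ω) (Ψ ω)) ∂P ≤
      ENNReal.ofReal ((1 + QuaternionSketch.gaussianFactor s l) *
        (1 + QuaternionSketch.gaussianFactor r s) * ‖QuaternionSketch.trailingBlock r σ‖ ^ 2) := by
    refine le_of_eq_of_le ?_ hlint
    rw [← hmap] at hmeas ⊢
    rw [lintegral_map' hmeas.aemeasurable.ennreal_ofReal hpair]
  have hnn : 0 ≤ᵐ[P] fun ω => QuaternionSketch.sketchError A (Ω ω) (Ψ ω) :=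
    Filter.Eventually.of_forall fun ω => sq_nonneg _
  have hint : Integrable (fun ω => QuaternionSketch.sketchError A (Ω ω) (Ψ ω)) P :=
    ⟨hmeasP, (hasFiniteIntegral_iff_ofReal hnn).2 (hlintP.trans_lt ENNReal.ofReal_lt_top)⟩
  refine ⟨hint.congr heq, ?_, ?_⟩
  · rw [← integral_congr_ae heq, integral_eq_lintegral_of_nonneg_ae hnn hmeasP]
    have h1 := QuaternionSketch.gaussianFactor_nonneg hrs
    have h2 := QuaternionSketch.gaussianFactor_nonneg hsl
    exact ENNReal.toReal_le_of_le_ofReal (by positivity) hlintP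
  · rw [QuaternionSketch.one_add_gaussianFactor hrs, QuaternionSketch.one_add_gaussianFactor hsl]
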